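/- Let $G$ be a finite group. A $G$-Mackey functor assigns to each finite $G$-set $X$ an abelian group $M(X)$, with restrictions $f^*\colon M(Y)\to M(X)$ and transfers $f_*\colon M(X)\to M(Y)$ for $G$-maps $f\colon X\to Y$, functorial, satisfying base change for pullback squares and sending finite disjoint unions to products. A Green functor is a Mackey functor with values in commutative rings whose restrictions are ring homomorphisms and which satisfies Frobenius reciprocity $y\cdot f_*(x)=f_*(f^*(y)\,x)$ (equivalently, a commutative monoid for the box product $\boxtimes$ of Mackey functors). Let $\underline R$ be a Green functor and let $\underline S$ be an $\underline R$-algebra, i.e. a Green functor with a morphism of Green functors $\underline R\to\underline S$. Let $\boxtimes_{\underline R}$ be the relative box product. The Hochschild homology $\mathrm{HH}_n(\underline S/\underline R)$ is the $n$-th homology $\underline S$-module of the cyclic nerve of $\underline S$ over $\underline R$, i.e. of the complex $C_n=\underline S^{\boxtimes_{\underline R}(n+1)}$, an $\underline S$-module through the first factor, whose differential is the alternating sum $\sum_i(-1)^i d_i$ of the face maps, where $d_i$ ($0\le i\le n-1$) multiplies two adjacent factors and $d_n$ multiplies the last factor into the first. Let $\underline I$ be the kernel of the multiplication $\mu\colon\underline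 S\boxtimes_{\underline R}\underline S\to\underline S$. Let $\underline I^{>1}$ be the smallest ideal of the Green functor $\underline S\boxtimes_{\underline R}\underline S$ containing all norms $N_f(i)$, where $i\in\underline I(X)$ and $f\colon X\to Y$ is a $G$-map of finite $G$-sets which preserves stabilizers and all of whose fibers have at least two elements. (For a stabilizer-preserving $f$, over each orbit of $Y$ the $G$-set $X$ is a disjoint union of copies of that orbit, and $N_f$ is the product over the copies.) The module of genuine Kähler differentials is the $\underline S$-module $$\Omega^{1,G}_{\underline S/\underline R}:=\underline I/\underline I^{>1},$$ with $\underline S$ acting through the first factor. Theorem. There is an isomorphism of $\underline S$-modules $$\mathrm{HH}_1(\underline S/\underline R)\;\cong\;\Omega^{1,G}_{\underline S/\underline R}.$$ -/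

import Mathlib

universe u v w

namespace EquivariantAlgebra

section GSets

variable (G : Type u) [Group G]

/-- A finite `G`-set. -/
structure FinGSet : Type (u + 1) where
  carrier : Type u
  [action : MulAction G carrier]
  [finite : Finite carrier]

attribute [instance] FinGSet.action FinGSet.finite

instance : CoeSort (FinGSet G) (Type u) := ⟨FinGSet.carrier⟩

end GSets

section

set_option linter.unusedVariables false

variable {G : Type u} [Group G]

/-- The fibre product `X ×_Z Y` of finite `G`-sets. -/
def fibreProduct {X Y Z : FinGSet G} (f : X →[G] Z) (g : Y →[G] Z) : FinGSet G where
  carrier := {p : X × Y // f p.1 = g p.2}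
  action :=
    { smul := fun γ p => ⟨(γ • p.1.1, γ • p.1.2), by
        have h := p.2
        simp only [map_smul, h]⟩
      one_smul := fun p => Subtype.ext (Prod.ext (one_smul G p.1.1) (one_smul G p.1.2))
      mul_smul := fun a b p =>
        Subtype.ext (Prod.ext (mul_smul a b p.1.1) (mul_smul a b p.1.2)) }
  finite := Subtype.finite

/-- The first projection `X ×_Z Y → X`. -/
def fibreFst {X Y Z : FinGSet G} (f : X →[G] Z) (g : Y →[G] Z) : fibreProduct f g →[G] X where
  toFun := fun p => p.1.1
  map_smul' := fun _ _ => rfl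

/-- The second projection `X ×_Z Y → Y`. -/
def fibreSnd {X Y Z : FinGSet G} (f : X →[G] Z) (g : Y →[G] Z) : fibreProduct f g →[G] Y where
  toFun := fun p => p.1.2
  map_smul' := fun _ _ => rfl

/-- The disjoint union of two finite `G`-sets. -/
def disjointUnion (X Y : FinGSet G) : FinGSet G where
  carrier := (X : Type u) ⊕ (Y : Type u)

/-- The inclusion `X → X ⊔ Y`. -/
def inlMap (X Y : FinGSet G) : X →[G] disjointUnion X Y where
  toFun := fun x => (Sum.inl x : (X : Type u) ⊕ (Y : Type u))
  map_smul' := fun _ _ => rfl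

/-- The inclusion `Y → X ⊔ Y`. -/
def inrMap (X Y : FinGSet G) : Y →[G] disjointUnion X Y where
  toFun := fun y => (Sum.inr y : (X : Type u) ⊕ (Y : Type u))
  map_smul' := fun _ _ => rfl

/-- The square
```
  W --f'--> Y
  |g'       |g
  X --f---> Z
```
is a pullback square of `G`-sets. -/
structure IsPullbackSquare {W X Y Z : FinGSet G} (f' : W →[G] Y) (g' : W →[G] X)
    (f : X →[G] Z) (g : Y →[G] Z) : Prop where
  comm : ∀ a, f (g' a) = g (f' a)
  existsUnique : ∀ x y, f x = g y → ∃! a, g' a = x ∧ f' a = y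

/-- The axioms of a Mackey functor: a family of abelian groups indexed by finite `G`-sets,
contravariant for restrictions and covariant for transfers, with base change along pullback
squares, and taking finite disjoint unions to products. -/
structure IsMackey (M : FinGSet G → Type v)
    (res : ∀ {X Y : FinGSet G}, (X →[G] Y) → M Y → M X)
    (tr : ∀ {X Y : FinGSet G}, (X →[G] Y) → M X → M Y) : Prop where
  res_id : ∀ (X : FinGSet G) (m : M X), res (MulActionHom.id G) m = m
  res_comp : ∀ {X Y Z : FinGSet G} (g : Y →[G] Z) (f : X →[G] Y) (m : M Z),
    res (g.comp f) m = res f (res g m)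
  tr_id : ∀ (X : FinGSet G) (m : M X), tr (MulActionHom.id G) m = m
  tr_comp : ∀ {X Y Z : FinGSet G} (g : Y →[G] Z) (f : X →[G] Y) (m : M X),
    tr (g.comp f) m = tr g (tr f m)
  base_change : ∀ {W X Y Z : FinGSet G} (f' : W →[G] Y) (g' : W →[G] X)
    (f : X →[G] Z) (g : Y →[G] Z), IsPullbackSquare f' g' f g →
    ∀ m : M X, res g (tr f m) = tr f' (res g' m)
  subsingleton_of_isEmpty : ∀ X : FinGSet G, IsEmpty X → Subsingleton (M X)
  bijective_disjointUnion : ∀ X Y : FinGSet G, Function.Bijective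
    (fun m : M (disjointUnion X Y) => (res (inlMap X Y) m, res (inrMap X Y) m))

/-- A (commutative) Green functor: a Mackey functor with values in commutative rings, whose
restrictions are ring homomorphisms and whose transfers satisfy Frobenius reciprocity. -/
structure GreenFunctor (G : Type u) [Group G] where
  obj : FinGSet G → Type v
  [ring : ∀ X, CommRing (obj X)]
  res : ∀ {X Y : FinGSet G}, (X →[G] Y) → obj Y →+* obj X
  tr : ∀ {X Y : FinGSet G}, (X →[G] Y) → obj X →+ obj Y
  isMackey : IsMackey obj (fun f => res f) (fun f => tr f)
  frobenius : ∀ {X Y : FinGSet G} (f : X →[G] Y) (y : obj Y) (x : obj X),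
    y * tr f x = tr f (res f y * x)

attribute [instance] GreenFunctor.ring

/-- A morphism of Green functors. -/
structure GreenHom (R : GreenFunctor.{u, v} G) (S : GreenFunctor.{u, w} G) where
  app : ∀ X, R.obj X →+* S.obj X
  app_res : ∀ {X Y : FinGSet G} (f : X →[G] Y) (r : R.obj Y),
    app X (R.res f r) = S.res f (app Y r)
  app_tr : ∀ {X Y : FinGSet G} (f : X →[G] Y) (r : R.obj X),
    app Y (R.tr f r) = S.tr f (app X r)

/-- A module over a Green functor. -/
structure GreenModule (S : GreenFunctor.{u, v} G) where
  obj : FinGSet G → Type w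
  [group : ∀ X, AddCommGroup (obj X)]
  [module : ∀ X, Module (S.obj X) (obj X)]
  res : ∀ {X Y : FinGSet G}, (X →[G] Y) → obj Y →+ obj X
  tr : ∀ {X Y : FinGSet G}, (X →[G] Y) → obj X →+ obj Y
  isMackey : IsMackey obj (fun f => res f) (fun f => tr f)
  res_smul : ∀ {X Y : FinGSet G} (f : X →[G] Y) (s : S.obj Y) (m : obj Y),
    res f (s • m) = S.res f s • res f m
  smul_tr : ∀ {X Y : FinGSet G} (f : X →[G] Y) (s : S.obj Y) (m : obj X),
    s • tr f m = tr f (S.res f s • m)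
  tr_smul : ∀ {X Y : FinGSet G} (f : X →[G] Y) (s : S.obj X) (m : obj Y),
    S.tr f s • m = tr f (s • res f m)

attribute [instance] GreenModule.group GreenModule.module

/-! ### Elementary facts on Mackey functors -/

theorem isPullbackSquare_fibre {X Y Z : FinGSet G} (f : X →[G] Z) (g : Y →[G] Z) :
    IsPullbackSquare (fibreSnd f g) (fibreFst f g) f g where
  comm := fun a => a.2
  existsUnique := fun x y h =>
    ⟨⟨(x, y), h⟩, ⟨rfl, rfl⟩, fun _ ha => Subtype.ext (Prod.ext ha.1 ha.2)⟩

theorem isPullbackSquare_swap {W X Y Z : FinGSet G} {f' : W →[G] Y} {g' : W →[G] X}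
    {f : X →[G] Z} {g : Y →[G] Z} (h : IsPullbackSquare f' g' f g) :
    IsPullbackSquare g' f' g f where
  comm := fun a => (h.comm a).symm
  existsUnique := fun x y hxy => by
    obtain ⟨a, ha, hu⟩ := h.existsUnique y x hxy.symm
    exact ⟨a, ha.symm, fun b hb => hu b hb.symm⟩

/-- The map into a fibre product. -/
def fibreLift {W X Y Z : FinGSet G} (f : X →[G] Z) (g : Y →[G] Z) (a : W →[G] X) (b : W →[G] Y)
    (h : ∀ t, f (a t) = g (b t)) : W →[G] fibreProduct f g where
  toFun := fun t => ⟨(a t, b t), h t⟩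
  map_smul' := fun γ t => Subtype.ext (Prod.ext (map_smul a γ t) (map_smul b γ t))

theorem isPullbackSquare_of_injective {X Y : FinGSet G} (f : X →[G] Y)
    (hf : Function.Injective f) :
    IsPullbackSquare (MulActionHom.id G : X →[G] X) (MulActionHom.id G : X →[G] X) f f where
  comm := fun _ => rfl
  existsUnique := fun x _ h => ⟨x, ⟨rfl, hf h⟩, fun _ ha => ha.1⟩

theorem isPullbackSquare_of_bijective {X Y : FinGSet G} (f : X →[G] Y)
    (hf : Function.Bijective f) :
    IsPullbackSquare f f (MulActionHom.id G : Y →[G] Y) (MulActionHom.id G : Y →[G] Y) where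
  comm := fun _ => rfl
  existsUnique := fun x y h => by
    obtain ⟨a, rfl⟩ := hf.2 x
    exact ⟨a, ⟨rfl, h⟩, fun _ hb => hf.1 hb.1⟩

namespace IsMackey

variable {M : FinGSet G → Type v}
  {res : ∀ {X Y : FinGSet G}, (X →[G] Y) → M Y → M X}
  {tr : ∀ {X Y : FinGSet G}, (X →[G] Y) → M X → M Y}

theorem res_tr_of_injective (h : IsMackey M res tr) {X Y : FinGSet G} (f : X →[G] Y)
    (hf : Function.Injective f) (m : M X) : res f (tr f m) = m := by
  rw [h.base_change _ _ _ _ (isPullbackSquare_of_injective f hf), h.res_id, h.tr_id]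

theorem tr_res_of_bijective (h : IsMackey M res tr) {X Y : FinGSet G} (f : X →[G] Y)
    (hf : Function.Bijective f) (m : M Y) : tr f (res f m) = m := by
  rw [← h.base_change _ _ _ _ (isPullbackSquare_of_bijective f hf), h.res_id, h.tr_id]

end IsMackey

theorem isEmpty_fibre {X Y Z : FinGSet G} (f : X →[G] Z) (g : Y →[G] Z)
    (h : ∀ x y, f x ≠ g y) : IsEmpty (fibreProduct f g) :=
  ⟨fun a => h _ _ a.2⟩

section additive

variable {M : FinGSet G → Type v} [∀ X, AddCommGroup (M X)]
  {res : ∀ {X Y : FinGSet G}, (X →[G] Y) → M Y →+ M X}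
  {tr : ∀ {X Y : FinGSet G}, (X →[G] Y) → M X →+ M Y}

theorem res_tr_of_disjoint
    (base_change : ∀ {W X Y Z : FinGSet G} (f' : W →[G] Y) (g' : W →[G] X)
      (f : X →[G] Z) (g : Y →[G] Z), IsPullbackSquare f' g' f g →
      ∀ m : M X, res g (tr f m) = tr f' (res g' m))
    (empty : ∀ X : FinGSet G, IsEmpty X → Subsingleton (M X))
    {X Y Z : FinGSet G} (f : X →[G] Z) (g : Y →[G] Z)
    (h : ∀ x y, f x ≠ g y) (m : M X) : res g (tr f m) = 0 := by
  rw [base_change _ _ _ _ (isPullbackSquare_fibre f g)]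
  have := empty _ (isEmpty_fibre f g h)
  rw [Subsingleton.elim (res (fibreFst f g) m) 0, map_zero]

/-- Given the other axioms, the additivity axiom follows from the decomposition
`m = tr (res m) + tr (res m)` along the two inclusions of a disjoint union. -/
theorem bijective_of_decomposition
    (res_id : ∀ (X : FinGSet G) (m : M X), res (MulActionHom.id G) m = m)
    (tr_id : ∀ (X : FinGSet G) (m : M X), tr (MulActionHom.id G) m = m)
    (base_change : ∀ {W X Y Z : FinGSet G} (f' : W →[G] Y) (g' : W →[G] X)
      (f : X →[G] Z) (g : Y →[G] Z), IsPullbackSquare f' g' f g →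
      ∀ m : M X, res g (tr f m) = tr f' (res g' m))
    (empty : ∀ X : FinGSet G, IsEmpty X → Subsingleton (M X))
    {X Y : FinGSet G}
    (hdec : ∀ m : M (disjointUnion X Y), m = tr (inlMap X Y) (res (inlMap X Y) m) +
      tr (inrMap X Y) (res (inrMap X Y) m)) :
    Function.Bijective
      (fun m : M (disjointUnion X Y) => (res (inlMap X Y) m, res (inrMap X Y) m)) := by
  have hinj : ∀ {A B : FinGSet G} (f : A →[G] B), Function.Injective f → ∀ m : M A,
      res f (tr f m) = m := fun f hf m => by
    rw [base_change _ _ _ _ (isPullbackSquare_of_injective f hf), res_id, tr_id]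
  constructor
  · intro a b hab
    have h1 := congrArg Prod.fst hab
    have h2 := congrArg Prod.snd hab
    simp only at h1 h2
    rw [hdec a, hdec b, h1, h2]
  · rintro ⟨a, b⟩
    refine ⟨tr (inlMap X Y) a + tr (inrMap X Y) b, ?_⟩
    simp only [map_add]
    rw [hinj (inlMap X Y) (fun _ _ h => Sum.inl_injective h),
      hinj (inrMap X Y) (fun _ _ h => Sum.inr_injective h),
      res_tr_of_disjoint base_change empty (inlMap X Y) (inrMap X Y)
        (fun _ _ h => Sum.inl_ne_inr h),
      res_tr_of_disjoint base_change empty (inrMap X Y) (inlMap X Y)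
        (fun _ _ h => Sum.inr_ne_inl h)]
    simp

theorem IsMackey.decomposition (h : IsMackey M (fun f => res f) (fun f => tr f))
    {X Y : FinGSet G} (m : M (disjointUnion X Y)) :
    m = tr (inlMap X Y) (res (inlMap X Y) m) + tr (inrMap X Y) (res (inrMap X Y) m) := by
  apply (h.bijective_disjointUnion X Y).1
  simp only [map_add]
  rw [h.res_tr_of_injective (inlMap X Y) (fun _ _ h => Sum.inl_injective h),
    h.res_tr_of_injective (inrMap X Y) (fun _ _ h => Sum.inr_injective h),
    res_tr_of_disjoint h.base_change h.subsingleton_of_isEmpty (inlMap X Y) (inrMap X Y)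
      (fun _ _ h => Sum.inl_ne_inr h),
    res_tr_of_disjoint h.base_change h.subsingleton_of_isEmpty (inrMap X Y) (inlMap X Y)
      (fun _ _ h => Sum.inr_ne_inl h)]
  simp

/-- The decomposition of an element along `A = A₁ ⊔ A₂`. -/
theorem IsMackey.decomposition_of_bijective (h : IsMackey M (fun f => res f) (fun f => tr f))
    {A₁ A₂ A : FinGSet G} (j₁ : A₁ →[G] A) (j₂ : A₂ →[G] A)
    (hj : Function.Bijective (Sum.elim j₁ j₂)) (m : M A) :
    m = tr j₁ (res j₁ m) + tr j₂ (res j₂ m) := by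
  let e : disjointUnion A₁ A₂ →[G] A :=
    { toFun := Sum.elim j₁ j₂
      map_smul' := by
        rintro γ (x | x)
        · exact map_smul j₁ γ x
        · exact map_smul j₂ γ x }
  have e₁ : j₁ = e.comp (inlMap A₁ A₂) := rfl
  have e₂ : j₂ = e.comp (inrMap A₁ A₂) := rfl
  conv_lhs => rw [← h.tr_res_of_bijective e hj m, h.decomposition (res e m)]
  rw [map_add, e₁, e₂, h.tr_comp, h.tr_comp, h.res_comp, h.res_comp]

end additive

namespace GreenFunctor

variable (S : GreenFunctor.{u, v} G)

theorem res_id {X : FinGSet G} (m : S.obj X) : S.res (MulActionHom.id G) m = m :=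
  S.isMackey.res_id X m

theorem res_comp {X Y Z : FinGSet G} (g : Y →[G] Z) (f : X →[G] Y) (m : S.obj Z) :
    S.res (g.comp f) m = S.res f (S.res g m) := S.isMackey.res_comp g f m

theorem tr_id {X : FinGSet G} (m : S.obj X) : S.tr (MulActionHom.id G) m = m :=
  S.isMackey.tr_id X m

theorem tr_comp {X Y Z : FinGSet G} (g : Y →[G] Z) (f : X →[G] Y) (m : S.obj X) :
    S.tr (g.comp f) m = S.tr g (S.tr f m) := S.isMackey.tr_comp g f m

theorem base_change {W X Y Z : FinGSet G} {f' : W →[G] Y} {g' : W →[G] X}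
    {f : X →[G] Z} {g : Y →[G] Z} (h : IsPullbackSquare f' g' f g) (m : S.obj X) :
    S.res g (S.tr f m) = S.tr f' (S.res g' m) := S.isMackey.base_change f' g' f g h m

end GreenFunctor

/-! ### Box powers of an algebra over a Green functor -/

/-- The generators of the box power of `S` with factors indexed by `ι`, at the `G`-set `X`:
a `G`-set `Y` over `X` together with one element of `S(Y)` for each factor, to be thought of as
the transfer along `Y → X` of a pure tensor at level `Y`. -/
structure BoxGenerator (S : GreenFunctor.{u, v} G) (ι : Type) (X : FinGSet G) where
  base : FinGSet G
  map : base →[G] X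
  val : ι → S.obj base

/-- The relations in the box power over `R` of `S`: additivity in each factor, `R`-balancedness,
and Frobenius reciprocity in each factor. -/
inductive BoxRelation {R : GreenFunctor.{u, w} G} {S : GreenFunctor.{u, v} G} (φ : GreenHom R S)
    (ι : Type) (X : FinGSet G) : FreeAbelianGroup (BoxGenerator S ι X) → Prop
  | add {Y : FinGSet G} (p : Y →[G] X) (a b c : ι → S.obj Y) (i : ι)
      (hi : c i = a i + b i) (ha : ∀ k, k ≠ i → a k = c k) (hb : ∀ k, k ≠ i → b k = c k) :
      BoxRelation φ ι X (FreeAbelianGroup.of ⟨Y, p, c⟩ -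
        (FreeAbelianGroup.of ⟨Y, p, a⟩ + FreeAbelianGroup.of ⟨Y, p, b⟩))
  | balanced {Y : FinGSet G} (p : Y →[G] X) (r : R.obj Y) (a b c : ι → S.obj Y) (i j : ι)
      (hi : a i = φ.app Y r * c i) (ha : ∀ k, k ≠ i → a k = c k)
      (hj : b j = φ.app Y r * c j) (hb : ∀ k, k ≠ j → b k = c k) :
      BoxRelation φ ι X (FreeAbelianGroup.of ⟨Y, p, a⟩ - FreeAbelianGroup.of ⟨Y, p, b⟩)
  | frobenius {Y Y' : FinGSet G} (f : Y →[G] Y') (p : Y' →[G] X) (a : ι → S.obj Y')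
      (b : ι → S.obj Y) (i : ι) (hi : a i = S.tr f (b i))
      (hb : ∀ k, k ≠ i → b k = S.res f (a k)) :
      BoxRelation φ ι X (FreeAbelianGroup.of ⟨Y', p, a⟩ - FreeAbelianGroup.of ⟨Y, p.comp f, b⟩)

/-- The value at `X` of the box power `S ⊠_R ⋯ ⊠_R S` with factors indexed by `ι`. -/
def Box {R : GreenFunctor.{u, w} G} {S : GreenFunctor.{u, v} G} (φ : GreenHom R S)
    (ι : Type) (X : FinGSet G) : Type (max (u + 1) v) :=
  FreeAbelianGroup (BoxGenerator S ι X) ⧸ AddSubgroup.closure {r | BoxRelation φ ι X r}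

namespace Box

variable {R : GreenFunctor.{u, w} G} {S : GreenFunctor.{u, v} G} {φ : GreenHom R S} {ι : Type}

instance (X : FinGSet G) : AddCommGroup (Box φ ι X) :=
  inferInstanceAs (AddCommGroup (FreeAbelianGroup (BoxGenerator S ι X) ⧸
    AddSubgroup.closure {r | BoxRelation φ ι X r}))

/-- The class of a generator. -/
def mk {X Y : FinGSet G} (p : Y →[G] X) (a : ι → S.obj Y) : Box φ ι X :=
  QuotientAddGroup.mk (FreeAbelianGroup.of ⟨Y, p, a⟩)

theorem mk_add {X Y : FinGSet G} (p : Y →[G] X) (a b c : ι → S.obj Y) (i : ι)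
    (hi : c i = a i + b i) (ha : ∀ k, k ≠ i → a k = c k) (hb : ∀ k, k ≠ i → b k = c k) :
    (mk p c : Box φ ι X) = mk p a + mk p b := by
  rw [← sub_eq_zero]
  exact (QuotientAddGroup.eq_zero_iff _).2
    (AddSubgroup.subset_closure (BoxRelation.add p a b c i hi ha hb))

theorem mk_balanced {X Y : FinGSet G} (p : Y →[G] X) (r : R.obj Y) (a b c : ι → S.obj Y)
    (i j : ι) (hi : a i = φ.app Y r * c i) (ha : ∀ k, k ≠ i → a k = c k)
    (hj : b j = φ.app Y r * c j) (hb : ∀ k, k ≠ j → b k = c k) :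
    (mk p a : Box φ ι X) = mk p b := by
  rw [← sub_eq_zero]
  exact (QuotientAddGroup.eq_zero_iff _).2
    (AddSubgroup.subset_closure (BoxRelation.balanced p r a b c i j hi ha hj hb))

theorem mk_frobenius {X Y Y' : FinGSet G} (f : Y →[G] Y') (p : Y' →[G] X) (a : ι → S.obj Y')
    (b : ι → S.obj Y) (i : ι) (hi : a i = S.tr f (b i))
    (hb : ∀ k, k ≠ i → b k = S.res f (a k)) :
    (mk p a : Box φ ι X) = mk (p.comp f) b := by
  rw [← sub_eq_zero]
  exact (QuotientAddGroup.eq_zero_iff _).2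
    (AddSubgroup.subset_closure (BoxRelation.frobenius f p a b i hi hb))

/-- Transport of a generator along an isomorphism. -/
theorem mk_eq_mk [Nonempty ι] {X Y Y' : FinGSet G} (e : Y →[G] Y') (he : Function.Bijective e)
    {p : Y →[G] X} {p' : Y' →[G] X} {a : ι → S.obj Y} {a' : ι → S.obj Y'}
    (hp : ∀ y, p y = p' (e y)) (ha : ∀ i, a i = S.res e (a' i)) :
    (mk p a : Box φ ι X) = mk p' a' := by
  obtain rfl : p = p'.comp e := MulActionHom.ext hp
  obtain ⟨i⟩ := ‹Nonempty ι›
  refine (mk_frobenius e p' a' a i ?_ fun k _ => ha k).symm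
  rw [ha i]
  exact (S.isMackey.tr_res_of_bijective e he (a' i)).symm

@[elab_as_elim]
theorem induction {X : FinGSet G} {P : Box φ ι X → Prop}
    (mk : ∀ {Y : FinGSet G} (p : Y →[G] X) (a : ι → S.obj Y), P (mk p a))
    (zero : P 0) (neg : ∀ x, P x → P (-x)) (add : ∀ x y, P x → P y → P (x + y))
    (x : Box φ ι X) : P x := by
  obtain ⟨x, rfl⟩ := QuotientAddGroup.mk_surjective x
  induction x using FreeAbelianGroup.induction_on with
  | zero => exact zero
  | of g => exact mk g.map g.val
  | neg g h => exact neg _ h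
  | add x y hx hy => exact add _ _ hx hy

/-- A family of elements of an abelian group, indexed by the generators and compatible with the
relations, defines a homomorphism from the box power. -/
def lift {A : Type*} [AddCommGroup A] {X : FinGSet G}
    (F : ∀ {Y : FinGSet G}, (Y →[G] X) → (ι → S.obj Y) → A)
    (hadd : ∀ {Y : FinGSet G} (p : Y →[G] X) (a b c : ι → S.obj Y) (i : ι),
      c i = a i + b i → (∀ k, k ≠ i → a k = c k) → (∀ k, k ≠ i → b k = c k) →
      F p c = F p a + F p b)
    (hbal : ∀ {Y : FinGSet G} (p : Y →[G] X) (r : R.obj Y) (a b c : ι → S.obj Y) (i j : ι),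
      a i = φ.app Y r * c i → (∀ k, k ≠ i → a k = c k) →
      b j = φ.app Y r * c j → (∀ k, k ≠ j → b k = c k) → F p a = F p b)
    (hfrob : ∀ {Y Y' : FinGSet G} (f : Y →[G] Y') (p : Y' →[G] X) (a : ι → S.obj Y')
      (b : ι → S.obj Y) (i : ι), a i = S.tr f (b i) →
      (∀ k, k ≠ i → b k = S.res f (a k)) → F p a = F (p.comp f) b) :
    Box φ ι X →+ A :=
  QuotientAddGroup.lift _ (FreeAbelianGroup.lift fun g => F g.map g.val) (by
    rw [AddSubgroup.closure_le]
    intro r hr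
    rw [SetLike.mem_coe, AddMonoidHom.mem_ker]
    induction hr with
    | add p a b c i hi ha hb =>
      simp only [map_sub, map_add, FreeAbelianGroup.lift_apply_of]
      rw [hadd p a b c i hi ha hb, sub_self]
    | balanced p r a b c i j hi ha hj hb =>
      simp only [map_sub, FreeAbelianGroup.lift_apply_of]
      rw [hbal p r a b c i j hi ha hj hb, sub_self]
    | frobenius f p a b i hi hb =>
      simp only [map_sub, FreeAbelianGroup.lift_apply_of]
      rw [hfrob f p a b i hi hb, sub_self])

theorem lift_mk {A : Type*} [AddCommGroup A] {X : FinGSet G}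
    (F : ∀ {Y : FinGSet G}, (Y →[G] X) → (ι → S.obj Y) → A) (hadd hbal hfrob)
    {Y : FinGSet G} (p : Y →[G] X) (a : ι → S.obj Y) :
    lift (φ := φ) (F := F) hadd hbal hfrob (mk p a) = F p a := by
  change FreeAbelianGroup.lift _ (FreeAbelianGroup.of _) = _
  rw [FreeAbelianGroup.lift_apply_of]

theorem hom_ext {A : Type*} [AddCommGroup A] {X : FinGSet G} {f g : Box φ ι X →+ A}
    (h : ∀ {Y : FinGSet G} (p : Y →[G] X) (a : ι → S.obj Y), f (mk p a) = g (mk p a)) :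
    f = g := by
  ext x
  induction x using Box.induction with
  | mk p a => exact h p a
  | zero => simp
  | neg x hx => simp [hx]
  | add x y hx hy => simp [hx, hy]

section structure_maps

/-- The map `f' : Y ×_Z W → Y' ×_Z W` induced by `f : Y → Y'` sits in a pullback square. -/
def fibreMap {Y Y' W Z : FinGSet G} (f : Y →[G] Y') (p : Y' →[G] Z) (q : W →[G] Z) :
    fibreProduct (p.comp f) q →[G] fibreProduct p q :=
  fibreLift p q (f.comp (fibreFst (p.comp f) q)) (fibreSnd (p.comp f) q) fun t => t.2

theorem isPullbackSquare_fibreMap {Y Y' W Z : FinGSet G} (f : Y →[G] Y') (p : Y' →[G] Z)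
    (q : W →[G] Z) :
    IsPullbackSquare (fibreMap f p q) (fibreFst (p.comp f) q) f (fibreFst p q) where
  comm := fun _ => rfl
  existsUnique := by
    rintro x ⟨⟨y, z⟩, hyz⟩ h
    obtain rfl : f x = y := h
    refine ⟨⟨(x, z), hyz⟩, ⟨rfl, rfl⟩, ?_⟩
    rintro ⟨⟨x', z'⟩, h'⟩ ⟨rfl, h2⟩
    have h3 : z' = z := congrArg (fun t => t.1.2) h2
    subst h3
    rfl

/-- Restriction along `g : X' → X`, given on generators by base change. -/
def res {X' X : FinGSet G} (g : X' →[G] X) : Box φ ι X →+ Box φ ι X' :=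
  lift (fun p a => mk (fibreSnd p g) fun i => S.res (fibreFst p g) (a i))
    (fun p a b c i hi ha hb => mk_add _ _ _ _ i (by simp [hi])
      (fun k hk => by simp [ha k hk]) (fun k hk => by simp [hb k hk]))
    (fun p r a b c i j hi ha hj hb =>
      mk_balanced _ (R.res (fibreFst p g) r) _ _ (fun k => S.res (fibreFst p g) (c k)) i j
        (by simp [hi, φ.app_res]) (fun k hk => by simp [ha k hk])
        (by simp [hj, φ.app_res]) (fun k hk => by simp [hb k hk]))
    (fun f p a b i hi hb => mk_frobenius (fibreMap f p g) (fibreSnd p g) _ _ i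
      (by rw [hi, S.base_change (isPullbackSquare_fibreMap f p g)])
      (fun k hk => by
        rw [hb k hk, ← S.res_comp, ← S.res_comp]
        rfl))

theorem res_mk {X X' Y : FinGSet G} (g : X' →[G] X) (p : Y →[G] X) (a : ι → S.obj Y) :
    res g (mk p a : Box φ ι X) = mk (fibreSnd p g) fun i => S.res (fibreFst p g) (a i) :=
  lift_mk _ _ _ _ _ _

/-- Transfer along `g : X → X'`, given on generators by composition. -/
def tr {X X' : FinGSet G} (g : X →[G] X') : Box φ ι X →+ Box φ ι X' :=
  lift (fun p a => mk (g.comp p) a)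
    (fun _ _ _ _ i hi ha hb => mk_add _ _ _ _ i hi ha hb)
    (fun _ r _ _ c i j hi ha hj hb => mk_balanced _ r _ _ c i j hi ha hj hb)
    (fun f p a b i hi hb => mk_frobenius f (g.comp p) a b i hi hb)

theorem tr_mk {X X' Y : FinGSet G} (g : X →[G] X') (p : Y →[G] X) (a : ι → S.obj Y) :
    tr g (mk p a : Box φ ι X) = mk (g.comp p) a :=
  lift_mk _ _ _ _ _ _

/-- Multiplication by a generator: at the level of a common refinement, pure tensors are
multiplied factor by factor. -/
def mulGen {X W : FinGSet G} (q : W →[G] X) (b : ι → S.obj W) : Box φ ι X →+ Box φ ι X :=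
  lift (fun p a => mk (p.comp (fibreFst p q))
      fun i => S.res (fibreFst p q) (a i) * S.res (fibreSnd p q) (b i))
    (fun p a a' c i hi ha hb => mk_add _ _ _ _ i (by simp [hi, add_mul])
      (fun k hk => by simp [ha k hk]) (fun k hk => by simp [hb k hk]))
    (fun p r a a' c i j hi ha hj hb =>
      mk_balanced _ (R.res (fibreFst p q) r) _ _
        (fun i => S.res (fibreFst p q) (c i) * S.res (fibreSnd p q) (b i)) i j
        (by simp [hi, φ.app_res, mul_assoc]) (fun k hk => by simp [ha k hk])
        (by simp [hj, φ.app_res, mul_assoc]) (fun k hk => by simp [hb k hk]))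
    (fun f p a a' i hi hb => mk_frobenius (fibreMap f p q) (p.comp (fibreFst p q)) _ _ i
      (by
        rw [hi, S.base_change (isPullbackSquare_fibreMap f p q), mul_comm, S.frobenius, mul_comm,
          ← S.res_comp]
        rfl)
      (fun k hk => by
        rw [hb k hk, map_mul, ← S.res_comp, ← S.res_comp, ← S.res_comp]
        rfl))

theorem mulGen_mk {X W Y : FinGSet G} (q : W →[G] X) (b : ι → S.obj W) (p : Y →[G] X)
    (a : ι → S.obj Y) :
    mulGen q b (mk p a : Box φ ι X) = mk (p.comp (fibreFst p q))
      fun i => S.res (fibreFst p q) (a i) * S.res (fibreSnd p q) (b i) :=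
  lift_mk _ _ _ _ _ _

variable [Nonempty ι]

theorem mulGen_comm {X W Y : FinGSet G} (q : W →[G] X) (b : ι → S.obj W) (p : Y →[G] X)
    (a : ι → S.obj Y) :
    mulGen q b (mk p a : Box φ ι X) = mulGen p a (mk q b) := by
  rw [mulGen_mk, mulGen_mk]
  refine mk_eq_mk (fibreLift q p (fibreSnd p q) (fibreFst p q) fun t => t.2.symm) ?_ ?_ ?_
  · constructor
    · rintro ⟨⟨x, y⟩, h⟩ ⟨⟨x', y'⟩, h'⟩ h2
      have h3 := congrArg (fun t => t.1.1) h2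
      have h4 := congrArg (fun t => t.1.2) h2
      exact Subtype.ext (Prod.ext h4 h3)
    · rintro ⟨⟨x, y⟩, h⟩
      exact ⟨⟨(y, x), h.symm⟩, rfl⟩
  · exact fun t => t.2
  · intro i
    rw [map_mul, ← S.res_comp, ← S.res_comp, mul_comm]
    rfl

/-- The multiplication of the box power. -/
def mulHom (X : FinGSet G) : Box φ ι X →+ Box φ ι X →+ Box φ ι X :=
  lift (fun q b => mulGen q b)
    (fun q a b c i hi ha hb => hom_ext fun p d => by
      rw [AddMonoidHom.add_apply, mulGen_comm q, mulGen_comm q, mulGen_comm q,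
        mk_add q a b c i hi ha hb, map_add])
    (fun q r a b c i j hi ha hj hb => hom_ext fun p d => by
      rw [mulGen_comm q, mulGen_comm q, mk_balanced q r a b c i j hi ha hj hb])
    (fun f q a b i hi hb => hom_ext fun p d => by
      rw [mulGen_comm q, mulGen_comm (q.comp f), mk_frobenius f q a b i hi hb])

theorem mulHom_mk {X W Y : FinGSet G} (q : W →[G] X) (b : ι → S.obj W) (p : Y →[G] X)
    (a : ι → S.obj Y) :
    mulHom X (mk p a : Box φ ι X) (mk q b) = mk (p.comp (fibreFst p q))
      fun i => S.res (fibreFst p q) (a i) * S.res (fibreSnd p q) (b i) := by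
  unfold mulHom
  rw [lift_mk, mulGen_comm, mulGen_mk]

theorem mulHom_comm {X : FinGSet G} (x y : Box φ ι X) : mulHom X x y = mulHom X y x := by
  induction x using Box.induction with
  | mk p a =>
    induction y using Box.induction with
    | mk q b => rw [mulHom_mk, ← mulGen_mk, mulGen_comm, mulGen_mk, mulHom_mk]
    | zero => simp
    | neg y hy => simp [hy]
    | add y y' hy hy' => simp [hy, hy']
  | zero => simp
  | neg x hx => simp [hx]
  | add x x' hx hx' => simp [hx, hx']

theorem mulHom_assoc {X : FinGSet G} (x y z : Box φ ι X) :
    mulHom X (mulHom X x y) z = mulHom X x (mulHom X y z) := by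
  induction x using Box.induction with
  | mk p a =>
    induction y using Box.induction with
    | mk q b =>
      induction z using Box.induction with
      | mk r c =>
        simp only [mulHom_mk]
        refine mk_eq_mk (fibreLift p (q.comp (fibreFst q r))
          ((fibreFst p q).comp (fibreFst _ r))
          (fibreLift q r ((fibreSnd p q).comp (fibreFst _ r)) (fibreSnd _ r)
            fun t => t.1.1.2.symm.trans t.2) fun t => t.1.1.2) ?_ ?_ ?_
        · constructor
          · rintro ⟨⟨⟨⟨x, y⟩, h⟩, z⟩, k⟩ ⟨⟨⟨⟨x', y'⟩, h'⟩, z'⟩, k'⟩ h2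
            have h3 : x = x' := congrArg (fun t => t.1.1) h2
            have h4 : y = y' := congrArg (fun t => t.1.2.1.1) h2
            have h5 : z = z' := congrArg (fun t => t.1.2.1.2) h2
            subst h3 h4 h5
            rfl
          · rintro ⟨⟨x, ⟨⟨y, z⟩, h⟩⟩, k⟩
            exact ⟨⟨(⟨(x, y), k⟩, z), k.trans h⟩, rfl⟩
        · exact fun t => rfl
        · intro i
          simp only [map_mul, ← S.res_comp, mul_assoc]
          rfl
      | zero => simp
      | neg z hz => simp [hz]
      | add z z' hz hz' => simp [hz, hz']
    | zero => simp
    | neg y hy => simp [hy]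
    | add y y' hy hy' => simp [hy, hy']
  | zero => simp
  | neg x hx => simp [hx]
  | add x x' hx hx' => simp [hx, hx']

/-- The product of `[X, id, a]` with a generator. -/
theorem mulHom_mk_id {X Y : FinGSet G} (b : ι → S.obj X) (p : Y →[G] X) (a : ι → S.obj Y) :
    mulHom X (mk (MulActionHom.id G) b : Box φ ι X) (mk p a) =
      mk p fun i => S.res p (b i) * a i := by
  rw [mulHom_mk]
  refine (mk_eq_mk (fibreLift (MulActionHom.id G : X →[G] X) p p (MulActionHom.id G)
    fun t => rfl) ?_ ?_ ?_).symm
  · constructor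
    · intro y y' h
      exact congrArg (fun t => t.1.2) h
    · rintro ⟨⟨x, y⟩, h⟩
      obtain rfl : x = p y := h
      exact ⟨y, rfl⟩
  · exact fun t => rfl
  · intro i
    rw [map_mul, ← S.res_comp, ← S.res_comp]
    congr 1
    exact (S.res_id (a i)).symm

instance (X : FinGSet G) : CommRing (Box φ ι X) :=
  { (inferInstance : AddCommGroup (Box φ ι X)) with
    mul := fun x y => mulHom X x y
    one := mk (MulActionHom.id G) fun _ => 1
    left_distrib := fun x y z => map_add (mulHom X x) y z
    right_distrib := fun x y z => by
      change mulHom X (x + y) z = mulHom X x z + mulHom X y z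
      rw [map_add, AddMonoidHom.add_apply]
    zero_mul := fun x => by
      change mulHom X 0 x = 0
      rw [map_zero, AddMonoidHom.zero_apply]
    mul_zero := fun x => map_zero (mulHom X x)
    mul_assoc := mulHom_assoc
    mul_comm := mulHom_comm
    one_mul := fun x => by
      change mulHom X (mk (MulActionHom.id G) fun _ => 1) x = x
      induction x using Box.induction with
      | mk p a => rw [mulHom_mk_id]; simp
      | zero => simp
      | neg x hx => rw [map_neg, hx]
      | add x y hx hy => rw [map_add, hx, hy]
    mul_one := fun x => by
      change mulHom X x (mk (MulActionHom.id G) fun _ => 1) = x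
      rw [mulHom_comm]
      induction x using Box.induction with
      | mk p a => rw [mulHom_mk_id]; simp
      | zero => simp
      | neg x hx => rw [map_neg, hx]
      | add x y hx hy => rw [map_add, hx, hy] }

theorem mk_mul_mk {X W Y : FinGSet G} (p : Y →[G] X) (a : ι → S.obj Y) (q : W →[G] X)
    (b : ι → S.obj W) :
    (mk p a * mk q b : Box φ ι X) = mk (p.comp (fibreFst p q))
      fun i => S.res (fibreFst p q) (a i) * S.res (fibreSnd p q) (b i) :=
  mulHom_mk q b p a

theorem mk_id_mul_mk {X Y : FinGSet G} (b : ι → S.obj X) (p : Y →[G] X) (a : ι → S.obj Y) :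
    (mk (MulActionHom.id G) b * mk p a : Box φ ι X) = mk p fun i => S.res p (b i) * a i :=
  mulHom_mk_id b p a

theorem one_def (X : FinGSet G) : (1 : Box φ ι X) = mk (MulActionHom.id G) fun _ => 1 := rfl

end structure_maps

section green

variable [Nonempty ι]

theorem res_id {X : FinGSet G} (x : Box φ ι X) : res (MulActionHom.id G) x = x := by
  induction x using Box.induction with
  | mk p a =>
    rw [res_mk]
    refine mk_eq_mk (fibreFst p (MulActionHom.id G)) ?_ (fun t => t.2.symm) fun i => rfl
    constructor
    · rintro ⟨⟨x, y⟩, h⟩ ⟨⟨x', y'⟩, h'⟩ h2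
      have h3 : x = x' := h2
      exact Subtype.ext (Prod.ext h3 (h.symm.trans ((congrArg p h3).trans h')))
    · intro y
      exact ⟨⟨(y, p y), rfl⟩, rfl⟩
  | zero => simp
  | neg x hx => rw [map_neg, hx]
  | add x y hx hy => rw [map_add, hx, hy]

theorem base_change {W X Y Z : FinGSet G} (f' : W →[G] Y) (g' : W →[G] X)
    (f : X →[G] Z) (g : Y →[G] Z) (h : IsPullbackSquare f' g' f g) (x : Box φ ι X) :
    res g (tr f x) = tr f' (res g' x) := by
  induction x using Box.induction with
  | mk p a =>
    rw [res_mk, tr_mk, tr_mk, res_mk]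
    refine (mk_eq_mk (fibreLift (f.comp p) g (fibreFst p g') (f'.comp (fibreSnd p g'))
      fun t => (congrArg f t.2).trans (h.comm _)) ?_ (fun t => rfl) ?_).symm
    · constructor
      · rintro ⟨⟨x, w⟩, k⟩ ⟨⟨x', w'⟩, k'⟩ h2
        have h3 : x = x' := congrArg (fun t => t.1.1) h2
        have h4 : f' w = f' w' := congrArg (fun t => t.1.2) h2
        subst h3
        have h5 : w = w' := (h.existsUnique (g' w) (f' w) (h.comm w)).unique ⟨rfl, rfl⟩
          ⟨k'.symm.trans k, h4.symm⟩
        subst h5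
        rfl
      · rintro ⟨⟨x, y⟩, k⟩
        obtain ⟨w, ⟨h1, h2⟩, -⟩ := h.existsUnique (p x) y k
        refine ⟨⟨(x, w), h1.symm⟩, Subtype.ext (Prod.ext rfl h2)⟩
    · intro i
      rw [← S.res_comp]
      rfl
  | zero => simp
  | neg x hx => simp only [map_neg, hx]
  | add x y hx hy => simp only [map_add, hx, hy]

theorem subsingleton_of_isEmpty (X : FinGSet G) (hX : IsEmpty X) : Subsingleton (Box φ ι X) := by
  have key : ∀ x : Box φ ι X, x = 0 := by
    intro x
    induction x using Box.induction with
    | @mk Y p a =>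
      have hY : IsEmpty Y := ⟨fun y => hX.false (p y)⟩
      have := S.isMackey.subsingleton_of_isEmpty Y hY
      obtain ⟨i⟩ := ‹Nonempty ι›
      have h := mk_add (φ := φ) p a a a i (Subsingleton.elim _ _) (fun _ _ => rfl)
        (fun _ _ => rfl)
      exact left_eq_add.mp h
    | zero => rfl
    | neg x hx => rw [hx, neg_zero]
    | add x y hx hy => rw [hx, hy, add_zero]
  exact ⟨fun x y => (key x).trans (key y).symm⟩

theorem decomposition {X Y : FinGSet G} (x : Box φ ι (disjointUnion X Y)) :
    x = tr (inlMap X Y) (res (inlMap X Y) x) + tr (inrMap X Y) (res (inrMap X Y) x) := by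
  classical
  induction x using Box.induction with
  | @mk A p a =>
    obtain ⟨i⟩ := ‹Nonempty ι›
    rw [res_mk, tr_mk, res_mk, tr_mk]
    have hj : Function.Bijective
        (Sum.elim (fibreFst p (inlMap X Y)) (fibreFst p (inrMap X Y))) := by
      constructor
      · rintro (⟨⟨x, y⟩, h⟩ | ⟨⟨x, y⟩, h⟩) (⟨⟨x', y'⟩, h'⟩ | ⟨⟨x', y'⟩, h'⟩) h2
        · obtain rfl : x = x' := h2
          obtain rfl : y = y' := Sum.inl_injective (h.symm.trans h')
          rfl
        · obtain rfl : x = x' := h2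
          exact (Sum.inl_ne_inr (h.symm.trans h')).elim
        · obtain rfl : x = x' := h2
          exact (Sum.inr_ne_inl (h.symm.trans h')).elim
        · obtain rfl : x = x' := h2
          obtain rfl : y = y' := Sum.inr_injective (h.symm.trans h')
          rfl
      · intro t
        rcases h : (show (X : Type u) ⊕ (Y : Type u) from p t) with x | y
        · exact ⟨Sum.inl ⟨(t, x), h⟩, rfl⟩
        · exact ⟨Sum.inr ⟨(t, y), h⟩, rfl⟩
    have hdec := S.isMackey.decomposition_of_bijective
      (res := fun f => (S.res f : _ →+ _)) (fibreFst p (inlMap X Y)) (fibreFst p (inrMap X Y)) hj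
      (a i)
    have key : ∀ {B : FinGSet G} (j : B →[G] A) (q : B →[G] disjointUnion X Y),
        p.comp j = q →
        (mk p (Function.update a i (S.tr j (S.res j (a i)))) : Box φ ι _) =
          mk q fun k => S.res j (a k) := by
      rintro B j q rfl
      refine mk_frobenius j p _ _ i (by simp) fun k hk => ?_
      rw [Function.update_of_ne hk]
    rw [mk_add p (Function.update a i _) (Function.update a i _) a i (by simpa using hdec)
      (fun k hk => Function.update_of_ne hk _ _) (fun k hk => Function.update_of_ne hk _ _)]
    congr 1
    · exact key (fibreFst p (inlMap X Y)) _ (MulActionHom.ext fun t => t.2)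
    · exact key (fibreFst p (inrMap X Y)) _ (MulActionHom.ext fun t => t.2)
  | zero => simp
  | neg x hx =>
    simp only [map_neg]
    rw [← neg_add, ← hx]
  | add x y hx hy =>
    simp only [map_add]
    rw [add_add_add_comm, ← hx, ← hy]

theorem res_comp {X Y Z : FinGSet G} (g : Y →[G] Z) (f : X →[G] Y) (x : Box φ ι Z) :
    res (g.comp f) x = res f (res g x) := by
  induction x using Box.induction with
  | mk p a =>
    rw [res_mk, res_mk, res_mk]
    refine mk_eq_mk (fibreLift (fibreSnd p g) f
      (fibreLift p g (fibreFst p (g.comp f)) (f.comp (fibreSnd p (g.comp f))) fun t => t.2)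
      (fibreSnd p (g.comp f)) fun t => rfl) ?_ (fun t => rfl) ?_
    · constructor
      · rintro ⟨⟨x, y⟩, h⟩ ⟨⟨x', y'⟩, h'⟩ h2
        have h3 : x = x' := congrArg (fun t => t.1.1.1.1) h2
        have h4 : y = y' := congrArg (fun t => t.1.2) h2
        subst h3 h4
        rfl
      · rintro ⟨⟨⟨⟨x, y⟩, h⟩, z⟩, k⟩
        obtain rfl : y = f z := k
        exact ⟨⟨(x, z), h⟩, rfl⟩
    · intro i
      rw [← S.res_comp, ← S.res_comp]
      rfl
  | zero => simp
  | neg x hx => simp only [map_neg, hx]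
  | add x y hx hy => simp only [map_add, hx, hy]

theorem tr_id {X : FinGSet G} (x : Box φ ι X) : tr (MulActionHom.id G) x = x := by
  induction x using Box.induction with
  | mk p a => rw [tr_mk, MulActionHom.id_comp]
  | zero => simp
  | neg x hx => rw [map_neg, hx]
  | add x y hx hy => rw [map_add, hx, hy]

theorem tr_comp {X Y Z : FinGSet G} (g : Y →[G] Z) (f : X →[G] Y) (x : Box φ ι X) :
    tr (g.comp f) x = tr g (tr f x) := by
  induction x using Box.induction with
  | mk p a => rw [tr_mk, tr_mk, tr_mk]; rfl
  | zero => simp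
  | neg x hx => simp only [map_neg, hx]
  | add x y hx hy => simp only [map_add, hx, hy]

theorem res_mul {X X' : FinGSet G} (g : X' →[G] X) (x y : Box φ ι X) :
    res g (x * y) = res g x * res g y := by
  induction x using Box.induction with
  | mk p a =>
    induction y using Box.induction with
    | mk q b =>
      rw [mk_mul_mk, res_mk, res_mk, res_mk, mk_mul_mk]
      refine mk_eq_mk (fibreLift (fibreSnd p g) (fibreSnd q g)
        (fibreLift p g ((fibreFst p q).comp (fibreFst _ g)) (fibreSnd _ g) fun t => t.2)
        (fibreLift q g ((fibreSnd p q).comp (fibreFst _ g)) (fibreSnd _ g)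
          fun t => t.1.1.2.symm.trans t.2) fun t => rfl) ?_ (fun t => rfl) ?_
      · constructor
        · rintro ⟨⟨⟨⟨x, y⟩, h⟩, z⟩, k⟩ ⟨⟨⟨⟨x', y'⟩, h'⟩, z'⟩, k'⟩ h2
          have h3 : x = x' := congrArg (fun t => t.1.1.1.1) h2
          have h4 : y = y' := congrArg (fun t => t.1.2.1.1) h2
          have h5 : z = z' := congrArg (fun t => t.1.2.1.2) h2
          subst h3 h4 h5
          rfl
        · rintro ⟨⟨⟨⟨x, z⟩, h⟩, ⟨⟨y, z'⟩, h'⟩⟩, k⟩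
          obtain rfl : z = z' := k
          exact ⟨⟨(⟨(x, y), h.trans h'.symm⟩, z), h⟩, rfl⟩
      · intro i
        simp only [map_mul, ← S.res_comp]
        rfl
    | zero => simp
    | neg x hx => simp only [map_neg, mul_neg, hx]
    | add x y hx hy => simp only [map_add, mul_add, hx, hy]
  | zero => simp
  | neg x hx => simp only [map_neg, neg_mul, hx]
  | add x y hx hy => simp only [map_add, add_mul, hx, hy]

theorem res_one {X X' : FinGSet G} (g : X' →[G] X) : res g (1 : Box φ ι X) = 1 := by
  rw [one_def, one_def, res_mk]
  refine mk_eq_mk (fibreSnd _ g) ?_ (fun t => rfl) fun i => by simp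
  constructor
  · rintro ⟨⟨x, y⟩, h⟩ ⟨⟨x', y'⟩, h'⟩ h2
    obtain rfl : y = y' := h2
    obtain rfl : x = x' := h.trans h'.symm
    rfl
  · intro y
    exact ⟨⟨(g y, y), rfl⟩, rfl⟩

theorem frobenius {X Y : FinGSet G} (f : X →[G] Y) (y : Box φ ι Y) (x : Box φ ι X) :
    y * tr f x = tr f (res f y * x) := by
  induction x using Box.induction with
  | mk p a =>
    induction y using Box.induction with
    | mk q b =>
      rw [tr_mk, mk_mul_mk, res_mk, mk_mul_mk, tr_mk]
      refine (mk_eq_mk (fibreLift q (f.comp p)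
        ((fibreFst q f).comp (fibreFst _ p)) (fibreSnd _ p)
          fun t => t.1.1.2.trans (congrArg f t.2)) ?_ (fun t => t.1.1.2.symm) ?_).symm
      · constructor
        · rintro ⟨⟨⟨⟨x, y⟩, h⟩, z⟩, k⟩ ⟨⟨⟨⟨x', y'⟩, h'⟩, z'⟩, k'⟩ h2
          have h3 : x = x' := congrArg (fun t => t.1.1) h2
          have h4 : z = z' := congrArg (fun t => t.1.2) h2
          subst h3 h4
          obtain rfl : y = y' := k.trans k'.symm
          rfl
        · rintro ⟨⟨x, z⟩, k⟩
          exact ⟨⟨(⟨(x, p z), k⟩, z), rfl⟩, rfl⟩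
      · intro i
        simp only [map_mul, ← S.res_comp]
        rfl
    | zero => simp
    | neg x hx => simp only [map_neg, neg_mul, hx]
    | add x y hx hy => simp only [map_add, add_mul, hx, hy]
  | zero => simp
  | neg x hx => simp only [map_neg, mul_neg, hx]
  | add x y hx hy => simp only [map_add, mul_add, hx, hy]

variable (φ ι) in
/-- The box power of `S` over `R` with factors indexed by `ι`, as a Green functor. -/
def green : GreenFunctor.{u, max (u + 1) v} G where
  obj := Box φ ι
  res := fun f =>
    { toFun := fun x => res f x
      map_zero' := map_zero _
      map_add' := map_add _
      map_one' := res_one f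
      map_mul' := res_mul f }
  tr := fun f => tr f
  isMackey :=
    { res_id := fun _ x => res_id x
      res_comp := res_comp
      tr_id := fun _ x => tr_id x
      tr_comp := tr_comp
      base_change := base_change
      subsingleton_of_isEmpty := subsingleton_of_isEmpty
      bijective_disjointUnion := fun X Y =>
        bijective_of_decomposition (res := fun f => res f) (tr := fun f => tr f)
          (fun _ x => res_id x) (fun _ x => tr_id x) base_change
          subsingleton_of_isEmpty decomposition }
  frobenius := frobenius

variable (φ) in
/-- The homomorphism of Green functors from `S` to its box power which is the inclusion of the
factor with index `i`: `s ↦ 1 ⊗ ⋯ ⊗ s ⊗ ⋯ ⊗ 1`. -/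
def inclusion [DecidableEq ι] (i : ι) : GreenHom S (green φ ι) where
  app := fun X =>
    RingHom.mk' (
      { toFun := fun s => mk (MulActionHom.id G) (Pi.mulSingle i s)
        map_one' := by rw [Pi.mulSingle_one]; rfl
        map_mul' := fun s t => by
          rw [mk_id_mul_mk, Pi.mulSingle_mul]
          congr 1
          funext k
          rw [S.res_id]
          rfl } : S.obj X →* Box φ ι X)
      (fun s t => mk_add _ _ _ _ i (by simp) (fun k hk => by simp [hk])
        (fun k hk => by simp [hk]))
  app_res := fun {X Y} f s => by
    change mk (MulActionHom.id G) (Pi.mulSingle i (S.res f s)) =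
      res f (mk (MulActionHom.id G) (Pi.mulSingle i s))
    rw [res_mk]
    refine (mk_eq_mk (fibreSnd _ f) ?_ (fun t => rfl) fun k => ?_).symm
    · constructor
      · rintro ⟨⟨x, y⟩, h⟩ ⟨⟨x', y'⟩, h'⟩ h2
        obtain rfl : y = y' := h2
        obtain rfl : x = x' := h.trans h'.symm
        rfl
      · intro y
        exact ⟨⟨(f y, y), rfl⟩, rfl⟩
    · by_cases hk : k = i
      · subst hk
        rw [Pi.mulSingle_eq_same, Pi.mulSingle_eq_same, ← S.res_comp]
        congr 2
        exact MulActionHom.ext fun t => t.2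
      · rw [Pi.mulSingle_eq_of_ne hk, Pi.mulSingle_eq_of_ne hk, map_one, map_one]
  app_tr := fun {X Y} f s => by
    change mk (MulActionHom.id G) (Pi.mulSingle i (S.tr f s)) =
      tr f (mk (MulActionHom.id G) (Pi.mulSingle i s))
    rw [tr_mk]
    exact mk_frobenius f (MulActionHom.id G) _ _ i (by simp) fun k hk => by simp [hk]

end green

section functoriality

theorem prod_eq_of_congr [Fintype ι] [DecidableEq ι] {A : Type*} [CommMonoid A] {a c : ι → A} (i : ι)
    (h : ∀ l, l ≠ i → a l = c l) : (∏ l, a l) = a i * ∏ l ∈ Finset.univ.erase i, c l := by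
  rw [← Finset.mul_prod_erase _ a (Finset.mem_univ i)]
  congr 1
  exact Finset.prod_congr rfl fun l hl => h l (Finset.ne_of_mem_erase hl)

variable {κ : Type} [Fintype ι] [DecidableEq κ]

/-- The product over a fibre of index sets, with one factor singled out. -/
theorem prod_fibre_eq [DecidableEq ι] {A : Type*} [CommMonoid A] (σ : ι → κ) (a : ι → A) (i : ι) :
    (∏ l with σ l = σ i, a l) = a i * ∏ l ∈ (Finset.univ.filter fun l => σ l = σ i).erase i, a l :=
  (Finset.mul_prod_erase _ a (by simp)).symm

theorem prod_fibre_congr {A : Type*} [CommMonoid A] (σ : ι → κ) {a c : ι → A} (i : ι)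
    (h : ∀ l, l ≠ i → a l = c l) (k : κ) (hk : k ≠ σ i) :
    (∏ l with σ l = k, a l) = ∏ l with σ l = k, c l := by
  refine Finset.prod_congr rfl fun l hl => h l ?_
  rintro rfl
  exact hk (Finset.mem_filter.1 hl).2.symm

variable (φ) in
/-- The homomorphism of box powers induced by a map of index sets, multiplying together the
factors with the same image. -/
def mapHom (σ : ι → κ) (X : FinGSet G) : Box φ ι X →+ Box φ κ X :=
  lift (fun p a => mk p fun k => ∏ i with σ i = k, a i)
    (fun p a b c i hi ha hb => by
      classical
      refine mk_add p _ _ _ (σ i) ?_ (fun k hk => prod_fibre_congr σ i ha k hk)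
        (fun k hk => prod_fibre_congr σ i hb k hk)
      rw [prod_fibre_eq, prod_fibre_eq, prod_fibre_eq, hi, add_mul]
      congr 2 <;> refine Finset.prod_congr rfl fun l hl => ?_
      · exact (ha l (Finset.ne_of_mem_erase hl)).symm
      · exact (hb l (Finset.ne_of_mem_erase hl)).symm)
    (fun p r a b c i j hi ha hj hb => by
      classical
      refine mk_balanced p r _ _ (fun k => ∏ i with σ i = k, c i) (σ i) (σ j) ?_
        (fun k hk => prod_fibre_congr σ i ha k hk) ?_
        (fun k hk => prod_fibre_congr σ j hb k hk)
      · rw [prod_fibre_eq, prod_fibre_eq, hi, mul_assoc]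
        congr 2
        exact Finset.prod_congr rfl fun l hl => ha l (Finset.ne_of_mem_erase hl)
      · rw [prod_fibre_eq, prod_fibre_eq, hj, mul_assoc]
        congr 2
        exact Finset.prod_congr rfl fun l hl => hb l (Finset.ne_of_mem_erase hl))
    (fun f p a b i hi hb => by
      classical
      refine mk_frobenius f p _ _ (σ i) ?_ fun k hk => ?_
      · rw [prod_fibre_eq, prod_fibre_eq, hi, mul_comm, S.frobenius, mul_comm, map_prod]
        congr 2
        exact Finset.prod_congr rfl fun l hl => (hb l (Finset.ne_of_mem_erase hl)).symm
      · rw [map_prod]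
        exact prod_fibre_congr σ i hb k hk)

theorem mapHom_mk (σ : ι → κ) {X Y : FinGSet G} (p : Y →[G] X) (a : ι → S.obj Y) :
    mapHom φ σ X (mk p a) = mk p fun k => ∏ i with σ i = k, a i :=
  lift_mk _ _ _ _ _ _

variable [Nonempty ι] [Nonempty κ]

variable (φ) in
/-- The homomorphism of Green functors between box powers induced by a map of index sets. -/
def map (σ : ι → κ) : GreenHom (green φ ι) (green φ κ) where
  app := fun X =>
    { toFun := fun x => mapHom φ σ X x
      map_zero' := map_zero _
      map_add' := map_add _
      map_one' := by
        change mapHom φ σ X (1 : Box φ ι X) = (1 : Box φ κ X)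
        rw [one_def, one_def, mapHom_mk]
        simp
      map_mul' := fun (x : Box φ ι X) (y : Box φ ι X) => by
        change mapHom φ σ X (x * y) = mapHom φ σ X x * mapHom φ σ X y
        induction x using Box.induction with
        | mk p a =>
          induction y using Box.induction with
          | mk q b =>
            rw [mk_mul_mk, mapHom_mk, mapHom_mk, mapHom_mk, mk_mul_mk]
            congr 1
            funext k
            rw [map_prod, map_prod, Finset.prod_mul_distrib]
          | zero => simp
          | neg x hx => simp only [map_neg, mul_neg, hx]
          | add x y hx hy => simp only [map_add, mul_add, hx, hy]
        | zero => simp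
        | neg x hx => simp only [map_neg, neg_mul, hx]
        | add x y hx hy => simp only [map_add, add_mul, hx, hy] }
  app_res := fun {X Y} f (x : Box φ ι Y) => by
    change mapHom φ σ X (res f x) = res f (mapHom φ σ Y x)
    induction x using Box.induction with
    | mk p a =>
      rw [res_mk, mapHom_mk, mapHom_mk, res_mk]
      simp only [map_prod]
    | zero => simp
    | neg x hx => simp only [map_neg, hx]
    | add x y hx hy => simp only [map_add, hx, hy]
  app_tr := fun {X Y} f (x : Box φ ι X) => by
    change mapHom φ σ Y (tr f x) = tr f (mapHom φ σ X x)
    induction x using Box.induction with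
    | mk p a => rw [tr_mk, mapHom_mk, mapHom_mk, tr_mk]
    | zero => simp
    | neg x hx => simp only [map_neg, hx]
    | add x y hx hy => simp only [map_add, hx, hy]

variable (φ ι) in
/-- The multiplication of the box power with values in `S`, as an additive homomorphism. -/
def mulMapHom (X : FinGSet G) : Box φ ι X →+ S.obj X :=
  lift (fun p a => S.tr p (∏ i, a i))
    (fun p a b c i hi ha hb => by
      classical
      rw [prod_eq_of_congr i ha, prod_eq_of_congr i hb, prod_eq_of_congr i (fun _ _ => rfl), hi,
        add_mul, map_add])
    (fun p r a b c i j hi ha hj hb => by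
      classical
      rw [prod_eq_of_congr i ha, prod_eq_of_congr j hb, hi, hj, mul_assoc, mul_assoc,
        Finset.mul_prod_erase _ c (Finset.mem_univ i),
        Finset.mul_prod_erase _ c (Finset.mem_univ j)])
    (fun f p a b i hi hb => by
      classical
      rw [S.tr_comp, prod_eq_of_congr i hb, prod_eq_of_congr i (fun _ _ => rfl), hi, mul_comm,
        S.frobenius, mul_comm, map_prod])

theorem mulMapHom_mk {X Y : FinGSet G} (p : Y →[G] X) (a : ι → S.obj Y) :
    mulMapHom φ ι X (mk p a) = S.tr p (∏ i, a i) :=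
  lift_mk _ _ _ _ _ _

variable (φ ι) in
/-- The multiplication `S ⊠_R ⋯ ⊠_R S → S`, a homomorphism of Green functors. -/
def mulMap : GreenHom (green φ ι) S where
  app := fun X =>
    { toFun := fun x => mulMapHom φ ι X x
      map_zero' := map_zero _
      map_add' := map_add _
      map_one' := by
        change mulMapHom φ ι X (1 : Box φ ι X) = 1
        rw [one_def, mulMapHom_mk, S.tr_id]
        simp
      map_mul' := fun (x : Box φ ι X) (y : Box φ ι X) => by
        change mulMapHom φ ι X (x * y) = mulMapHom φ ι X x * mulMapHom φ ι X y
        induction x using Box.induction with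
        | mk p a =>
          induction y using Box.induction with
          | mk q b =>
            rw [mk_mul_mk, mulMapHom_mk, mulMapHom_mk, mulMapHom_mk, Finset.prod_mul_distrib,
              mul_comm (S.tr p _), S.frobenius, S.base_change
                (isPullbackSquare_swap (isPullbackSquare_fibre p q)),
              mul_comm (S.tr (fibreFst p q) _), S.frobenius, S.tr_comp, map_prod, map_prod]
          | zero => simp
          | neg x hx => simp only [map_neg, mul_neg, hx]
          | add x y hx hy => simp only [map_add, mul_add, hx, hy]
        | zero => simp
        | neg x hx => simp only [map_neg, neg_mul, hx]
        | add x y hx hy => simp only [map_add, add_mul, hx, hy] }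
  app_res := fun {X Y} f (x : Box φ ι Y) => by
    change mulMapHom φ ι X (res f x) = S.res f (mulMapHom φ ι Y x)
    induction x using Box.induction with
    | mk p a =>
      rw [res_mk, mulMapHom_mk, mulMapHom_mk, S.base_change (isPullbackSquare_fibre p f),
        ← map_prod]
    | zero => simp
    | neg x hx => simp only [map_neg, hx]
    | add x y hx hy => simp only [map_add, hx, hy]
  app_tr := fun {X Y} f (x : Box φ ι X) => by
    change mulMapHom φ ι Y (tr f x) = S.tr f (mulMapHom φ ι X x)
    induction x using Box.induction with
    | mk p a => rw [tr_mk, mulMapHom_mk, mulMapHom_mk, S.tr_comp]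
    | zero => simp
    | neg x hx => simp only [map_neg, hx]
    | add x y hx hy => simp only [map_add, hx, hy]

theorem map_inclusion [DecidableEq ι] (σ : ι → κ) (i : ι) {X : FinGSet G} (s : S.obj X) :
    (map φ σ).app X ((inclusion φ i).app X s) = (inclusion φ (σ i)).app X s := by
  change mapHom φ σ X (mk (MulActionHom.id G) (Pi.mulSingle i s)) =
    mk (MulActionHom.id G) (Pi.mulSingle (σ i) s)
  rw [mapHom_mk]
  congr 1
  funext k
  by_cases hk : k = σ i
  · subst hk
    rw [Pi.mulSingle_eq_same, Finset.prod_eq_single i, Pi.mulSingle_eq_same]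
    · intro l _ hl
      exact Pi.mulSingle_eq_of_ne (M := fun _ => S.obj X) hl s
    · simp
  · rw [Pi.mulSingle_eq_of_ne hk]
    refine Finset.prod_eq_one fun l hl =>
      Pi.mulSingle_eq_of_ne (M := fun _ => S.obj X) ?_ s
    rintro rfl
    exact hk (Finset.mem_filter.1 hl).2.symm

end functoriality

end Box

/-! ### Modules over Green functors -/

namespace GreenModule

variable {S : GreenFunctor.{u, v} G}

/-- A Green functor as a module over itself. -/
def self (S : GreenFunctor.{u, v} G) : GreenModule.{u, v, v} S where
  obj := S.obj
  res := fun f => (S.res f : _ →+ _)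
  tr := fun f => S.tr f
  isMackey := S.isMackey
  res_smul := fun f s m => map_mul (S.res f) s m
  smul_tr := fun f s m => S.frobenius f s m
  tr_smul := fun f s m => by
    change S.tr f s * m = S.tr f (s * S.res f m)
    rw [mul_comm, S.frobenius, mul_comm]

/-- Restriction of scalars along a morphism of Green functors. -/
def restrictScalars {T : GreenFunctor.{u, w} G} (ψ : GreenHom S T) (M : GreenModule T) :
    GreenModule S where
  obj := M.obj
  module := fun X => Module.compHom (M.obj X) (ψ.app X)
  res := fun f => M.res f
  tr := fun f => M.tr f
  isMackey := M.isMackey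
  res_smul := fun {X Y} f s m => by
    change M.res f (ψ.app Y s • m) = ψ.app X (S.res f s) • M.res f m
    rw [M.res_smul, ψ.app_res]
  smul_tr := fun {X Y} f s m => by
    change ψ.app Y s • M.tr f m = M.tr f (ψ.app X (S.res f s) • m)
    rw [M.smul_tr, ψ.app_res]
  tr_smul := fun {X Y} f s m => by
    change ψ.app Y (S.tr f s) • m = M.tr f (ψ.app X s • M.res f m)
    rw [← M.tr_smul, ψ.app_tr]

/-- A homomorphism of modules over a Green functor. -/
structure Hom (M : GreenModule.{u, v, w} S) (N : GreenModule.{u, v, w} S) where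
  app : ∀ X, M.obj X →ₗ[S.obj X] N.obj X
  app_res : ∀ {X Y : FinGSet G} (f : X →[G] Y) (m : M.obj Y),
    app X (M.res f m) = N.res f (app Y m)
  app_tr : ∀ {X Y : FinGSet G} (f : X →[G] Y) (m : M.obj X),
    app Y (M.tr f m) = N.tr f (app X m)

/-- An isomorphism of modules over a Green functor. -/
structure Iso (M : GreenModule.{u, v, w} S) (N : GreenModule.{u, v, w} S) where
  app : ∀ X, M.obj X ≃ₗ[S.obj X] N.obj X
  app_res : ∀ {X Y : FinGSet G} (f : X →[G] Y) (m : M.obj Y),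
    app X (M.res f m) = N.res f (app Y m)
  app_tr : ∀ {X Y : FinGSet G} (f : X →[G] Y) (m : M.obj X),
    app Y (M.tr f m) = N.tr f (app X m)

/-- A submodule of a module over a Green functor. -/
structure Sub (M : GreenModule.{u, v, w} S) where
  carrier : ∀ X, Submodule (S.obj X) (M.obj X)
  res_mem : ∀ {X Y : FinGSet G} (f : X →[G] Y) {m : M.obj Y},
    m ∈ carrier Y → M.res f m ∈ carrier X
  tr_mem : ∀ {X Y : FinGSet G} (f : X →[G] Y) {m : M.obj X},
    m ∈ carrier X → M.tr f m ∈ carrier Y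

variable {M N : GreenModule.{u, v, w} S}

/-- The kernel of a homomorphism. -/
def ker (h : Hom M N) : Sub M where
  carrier := fun X => LinearMap.ker (h.app X)
  res_mem := fun f m hm => by
    rw [LinearMap.mem_ker] at hm ⊢
    rw [h.app_res, hm, map_zero]
  tr_mem := fun f m hm => by
    rw [LinearMap.mem_ker] at hm ⊢
    rw [h.app_tr, hm, map_zero]

/-- The image of a homomorphism. -/
def range (h : Hom M N) : Sub N where
  carrier := fun X => LinearMap.range (h.app X)
  res_mem := by
    rintro X Y f _ ⟨m, rfl⟩
    exact ⟨M.res f m, h.app_res f m⟩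
  tr_mem := by
    rintro X Y f _ ⟨m, rfl⟩
    exact ⟨M.tr f m, h.app_tr f m⟩

namespace Sub

/-- The whole module as a submodule. -/
def top (M : GreenModule.{u, v, w} S) : Sub M where
  carrier := fun _ => ⊤
  res_mem := fun _ _ _ => Submodule.mem_top
  tr_mem := fun _ _ _ => Submodule.mem_top

/-- The restriction of a submodule. -/
def subRes (K : Sub M) {X Y : FinGSet G} (f : X →[G] Y) : K.carrier Y →+ K.carrier X where
  toFun := fun m => ⟨M.res f m.1, K.res_mem f m.2⟩
  map_zero' := Subtype.ext (map_zero (M.res f))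
  map_add' := fun m m' => Subtype.ext (map_add (M.res f) m.1 m'.1)

/-- The transfer of a submodule. -/
def subTr (K : Sub M) {X Y : FinGSet G} (f : X →[G] Y) : K.carrier X →+ K.carrier Y where
  toFun := fun m => ⟨M.tr f m.1, K.tr_mem f m.2⟩
  map_zero' := Subtype.ext (map_zero (M.tr f))
  map_add' := fun m m' => Subtype.ext (map_add (M.tr f) m.1 m'.1)

/-- A submodule as a module. -/
def toModule (K : Sub M) : GreenModule.{u, v, w} S where
  obj := fun X => K.carrier X
  res := fun f => K.subRes f
  tr := fun f => K.subTr f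
  isMackey :=
    { res_id := fun X m => Subtype.ext (M.isMackey.res_id X m.1)
      res_comp := fun g f m => Subtype.ext (M.isMackey.res_comp g f m.1)
      tr_id := fun X m => Subtype.ext (M.isMackey.tr_id X m.1)
      tr_comp := fun g f m => Subtype.ext (M.isMackey.tr_comp g f m.1)
      base_change := fun f' g' f g h m => Subtype.ext (M.isMackey.base_change f' g' f g h m.1)
      subsingleton_of_isEmpty := fun X hX =>
        have := M.isMackey.subsingleton_of_isEmpty X hX
        inferInstance
      bijective_disjointUnion := fun X Y => bijective_of_decomposition
        (M := fun X => K.carrier X) (res := fun f => K.subRes f) (tr := fun f => K.subTr f)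
        (fun X m => Subtype.ext (M.isMackey.res_id X m.1))
        (fun X m => Subtype.ext (M.isMackey.tr_id X m.1))
        (fun f' g' f g h m => Subtype.ext (M.isMackey.base_change f' g' f g h m.1))
        (fun X hX =>
          have := M.isMackey.subsingleton_of_isEmpty X hX
          inferInstance)
        (fun m => Subtype.ext (M.isMackey.decomposition m.1)) }
  res_smul := fun f s m => Subtype.ext (M.res_smul f s m.1)
  smul_tr := fun f s m => Subtype.ext (M.smul_tr f s m.1)
  tr_smul := fun f s m => Subtype.ext (M.tr_smul f s m.1)

/-- The restriction of the quotient by a submodule. -/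
def quotientRes (K : Sub M) {X Y : FinGSet G} (f : X →[G] Y) :
    (M.obj Y ⧸ K.carrier Y) →+ (M.obj X ⧸ K.carrier X) :=
  QuotientAddGroup.map (K.carrier Y).toAddSubgroup (K.carrier X).toAddSubgroup (M.res f)
    fun _ hm => K.res_mem f hm

/-- The transfer of the quotient by a submodule. -/
def quotientTr (K : Sub M) {X Y : FinGSet G} (f : X →[G] Y) :
    (M.obj X ⧸ K.carrier X) →+ (M.obj Y ⧸ K.carrier Y) :=
  QuotientAddGroup.map (K.carrier X).toAddSubgroup (K.carrier Y).toAddSubgroup (M.tr f)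
    fun _ hm => K.tr_mem f hm

theorem quotientRes_mk (K : Sub M) {X Y : FinGSet G} (f : X →[G] Y) (m : M.obj Y) :
    K.quotientRes f (Submodule.Quotient.mk m) = Submodule.Quotient.mk (M.res f m) := rfl

theorem quotientTr_mk (K : Sub M) {X Y : FinGSet G} (f : X →[G] Y) (m : M.obj X) :
    K.quotientTr f (Submodule.Quotient.mk m) = Submodule.Quotient.mk (M.tr f m) := rfl

/-- The quotient of a module by a submodule, formed levelwise. -/
def quotient (K : Sub M) : GreenModule.{u, v, w} S :=
  have res_id : ∀ (X : FinGSet G) (m : M.obj X ⧸ K.carrier X),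
      K.quotientRes (MulActionHom.id G) m = m := fun X m => by
    induction m using Submodule.Quotient.induction_on with
    | _ m => exact congrArg Submodule.Quotient.mk (M.isMackey.res_id X m)
  have tr_id : ∀ (X : FinGSet G) (m : M.obj X ⧸ K.carrier X),
      K.quotientTr (MulActionHom.id G) m = m := fun X m => by
    induction m using Submodule.Quotient.induction_on with
    | _ m => exact congrArg Submodule.Quotient.mk (M.isMackey.tr_id X m)
  have base_change : ∀ {W X Y Z : FinGSet G} (f' : W →[G] Y) (g' : W →[G] X)
      (f : X →[G] Z) (g : Y →[G] Z), IsPullbackSquare f' g' f g →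
      ∀ m : M.obj X ⧸ K.carrier X,
        K.quotientRes g (K.quotientTr f m) = K.quotientTr f' (K.quotientRes g' m) :=
    fun f' g' f g h m => by
      induction m using Submodule.Quotient.induction_on with
      | _ m => exact congrArg Submodule.Quotient.mk (M.isMackey.base_change f' g' f g h m)
  have empty : ∀ X : FinGSet G, IsEmpty X → Subsingleton (M.obj X ⧸ K.carrier X) :=
    fun X hX =>
      have := M.isMackey.subsingleton_of_isEmpty X hX
      (Submodule.Quotient.mk_surjective (K.carrier X)).subsingleton
  { obj := fun X => M.obj X ⧸ K.carrier X
    res := fun f => K.quotientRes f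
    tr := fun f => K.quotientTr f
    isMackey :=
      { res_id := res_id
        res_comp := fun g f m => by
          induction m using Submodule.Quotient.induction_on with
          | _ m => exact congrArg Submodule.Quotient.mk (M.isMackey.res_comp g f m)
        tr_id := tr_id
        tr_comp := fun g f m => by
          induction m using Submodule.Quotient.induction_on with
          | _ m => exact congrArg Submodule.Quotient.mk (M.isMackey.tr_comp g f m)
        base_change := base_change
        subsingleton_of_isEmpty := empty
        bijective_disjointUnion := fun X Y => bijective_of_decomposition
          res_id tr_id base_change empty fun m => by
            induction m using Submodule.Quotient.induction_on with
            | _ m => exact congrArg Submodule.Quotient.mk (M.isMackey.decomposition m) }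
    res_smul := fun f s m => by
      induction m using Submodule.Quotient.induction_on with
      | _ m => exact congrArg Submodule.Quotient.mk (M.res_smul f s m)
    smul_tr := fun f s m => by
      induction m using Submodule.Quotient.induction_on with
      | _ m => exact congrArg Submodule.Quotient.mk (M.smul_tr f s m)
    tr_smul := fun f s m => by
      induction m using Submodule.Quotient.induction_on with
      | _ m => exact congrArg Submodule.Quotient.mk (M.tr_smul f s m) }

/-- The quotient `K / L` of a submodule `K` by a submodule `L`; when `L` is not contained in `K`
this is `K / (L ∩ K)`. -/
def quotientBy (K L : Sub M) : GreenModule.{u, v, w} S :=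
  quotient (M := K.toModule)
    { carrier := fun X => (L.carrier X).submoduleOf (K.carrier X)
      res_mem := fun f _ hm => L.res_mem f hm
      tr_mem := fun f _ hm => L.tr_mem f hm }

end Sub

end GreenModule

/-! ### Hochschild homology -/

section Hochschild

variable {R : GreenFunctor.{u, w} G} {S : GreenFunctor.{u, v} G} (φ : GreenHom R S)

/-- The map of indices underlying the face map `d_i : C_{n+1} → C_n` of the cyclic nerve: for
`i ≤ n` it identifies `i` with `i + 1`, and for `i = n + 1` it wraps the last index around to
`0`. -/
def faceIndex (n : ℕ) (i : Fin (n + 2)) : Fin (n + 2) → Fin (n + 1) :=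
  if h : i = Fin.last (n + 1) then
    fun j => if hj : j = Fin.last (n + 1) then 0 else j.castPred hj
  else (i.castPred h).predAbove

theorem faceIndex_zero (n : ℕ) (i : Fin (n + 2)) : faceIndex n i 0 = 0 := by
  unfold faceIndex
  split_ifs with h
  · have : (0 : Fin (n + 2)) ≠ Fin.last (n + 1) := (Fin.last_pos).ne
    simp [this]
  · simp

/-- The module of Hochschild chains `C_n(S/R) = S ⊠_R S ⊠_R ⋯ ⊠_R S` with `n + 1` factors, an
`S`-module through the first factor. -/
def hochschildChains (n : ℕ) : GreenModule.{u, v, max (u + 1) v} S :=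
  (GreenModule.self (Box.green φ (Fin (n + 1)))).restrictScalars (Box.inclusion φ 0)

/-- The face map `d_i : C_{n+1} → C_n` of the cyclic nerve of `S` over `R`:
`d_i (a_0 ⊗ ⋯ ⊗ a_{n+1}) = a_0 ⊗ ⋯ ⊗ a_i a_{i+1} ⊗ ⋯ ⊗ a_{n+1}` for `i ≤ n` and
`d_{n+1} (a_0 ⊗ ⋯ ⊗ a_{n+1}) = a_{n+1} a_0 ⊗ a_1 ⊗ ⋯ ⊗ a_n`. -/
def hochschildFace (n : ℕ) (i : Fin (n + 2)) :
    GreenModule.Hom (hochschildChains φ (n + 1)) (hochschildChains φ n) where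
  app := fun X =>
    { toFun := fun x => (Box.map φ (faceIndex n i)).app X x
      map_add' := map_add ((Box.map φ (faceIndex n i)).app X)
      map_smul' := fun s (x : (Box.green φ (Fin (n + 2))).obj X) => by
        change (Box.map φ (faceIndex n i)).app X ((Box.inclusion φ 0).app X s * x) =
          (Box.inclusion φ 0).app X s * (Box.map φ (faceIndex n i)).app X x
        rw [map_mul, Box.map_inclusion, faceIndex_zero] }
  app_res := fun f x => (Box.map φ (faceIndex n i)).app_res f x
  app_tr := fun f x => (Box.map φ (faceIndex n i)).app_tr f x

/-- The Hochschild differential `C_{n+1} → C_n`, the alternating sum of the face maps. -/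
def hochschildBoundary (n : ℕ) :
    GreenModule.Hom (hochschildChains φ (n + 1)) (hochschildChains φ n) where
  app := fun X => ∑ i : Fin (n + 2), (-1 : ℤ) ^ (i : ℕ) • (hochschildFace φ n i).app X
  app_res := fun f x => by
    simp only [LinearMap.sum_apply, LinearMap.smul_apply, map_sum, map_zsmul,
      (hochschildFace φ n _).app_res]
  app_tr := fun f x => by
    simp only [LinearMap.sum_apply, LinearMap.smul_apply, map_sum, map_zsmul,
      (hochschildFace φ n _).app_tr]

/-- The Hochschild cycles. -/
def hochschildCycles : ∀ n : ℕ, (hochschildChains φ n).Sub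
  | 0 => GreenModule.Sub.top _
  | n + 1 => GreenModule.ker (hochschildBoundary φ n)

/-- The Hochschild homology `HH_n(S/R)`: cycles modulo boundaries, as an `S`-module. -/
def hochschildHomology (n : ℕ) : GreenModule.{u, v, max (u + 1) v} S :=
  (hochschildCycles φ n).quotientBy (GreenModule.range (hochschildBoundary φ n))

end Hochschild

/-! ### Norms along isotropy-preserving maps -/

section Norm

/-- A map of `G`-sets is isotropy-preserving if it preserves stabilizers. These are the admissible
maps of the least indexing category, i.e. the maps along which every Green functor has norms. -/
def IsotropyPreserving {X Y : FinGSet G} (f : X →[G] Y) : Prop :=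
  ∀ x : X, MulAction.stabilizer G (f x) = MulAction.stabilizer G x

/-- A transitive `G`-set (nonempty, with a single orbit). -/
def IsOrbit (Z : FinGSet G) : Prop :=
  Nonempty Z ∧ ∀ z z' : Z, ∃ γ : G, γ • z = z'

variable (T : GreenFunctor.{u, v} G)

/-- The lifts of `j : Z → Y` along `f : X → Y`. -/
def Lifts {X Y Z : FinGSet G} (f : X →[G] Y) (j : Z →[G] Y) : Type u :=
  {σ : Z →[G] X // f.comp σ = j}

theorem IsOrbit.hom_ext {Z X : FinGSet G} (hZ : IsOrbit Z) {σ τ : Z →[G] X} (z : Z)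
    (h : σ z = τ z) : σ = τ := by
  ext z'
  obtain ⟨γ, rfl⟩ := hZ.2 z z'
  rw [map_smul, map_smul, h]

theorem IsOrbit.exists_hom {Z X : FinGSet G} (hZ : IsOrbit Z) (z : Z) (x : X)
    (h : MulAction.stabilizer G z ≤ MulAction.stabilizer G x) : ∃ σ : Z →[G] X, σ z = x := by
  choose γ hγ using hZ.2 z
  have key : ∀ a b : G, a • z = b • z → a • x = b • x := by
    intro a b hab
    have h1 : b⁻¹ * a ∈ MulAction.stabilizer G z := by
      rw [MulAction.mem_stabilizer_iff, mul_smul, hab, inv_smul_smul]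
    have h2 := MulAction.mem_stabilizer_iff.1 (h h1)
    rw [mul_smul, inv_smul_eq_iff] at h2
    exact h2
  refine ⟨⟨fun z' => γ z' • x, fun a z' => ?_⟩, ?_⟩
  · rw [smul_smul]
    refine key _ _ ?_
    rw [hγ, mul_smul, hγ]
    rfl
  · change γ z • x = x
    conv_rhs => rw [← one_smul G x]
    exact key _ _ (by rw [hγ, one_smul])

/-- The product of the restrictions of `s` along all lifts of `j : Z → Y` along `f : X → Y`. -/
noncomputable def liftProduct {X Y Z : FinGSet G} (f : X →[G] Y) (s : T.obj X) (j : Z →[G] Y) :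
    T.obj Z :=
  ∏ᶠ σ : Lifts f j, T.res σ.1 s

theorem finite_lifts {X Y Z : FinGSet G} (f : X →[G] Y) (j : Z →[G] Y) : Finite (Lifts f j) :=
  Finite.of_injective (fun σ : Lifts f j => (σ.1 : Z → X))
    fun _ _ h => Subtype.ext (MulActionHom.ext (congrFun h))

theorem res_liftProduct {X Y Z Z' : FinGSet G} (f : X →[G] Y) (hf : IsotropyPreserving f)
    (s : T.obj X) (hZ : IsOrbit Z) (hZ' : IsOrbit Z') (j : Z →[G] Y) (k : Z' →[G] Z) :
    T.res k (liftProduct T f s j) = liftProduct T f s (j.comp k) := by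
  have := finite_lifts f j
  unfold liftProduct
  rw [map_finprod (T.res k) (Set.toFinite _)]
  refine finprod_eq_of_bijective
    (fun σ : Lifts f j => (⟨σ.1.comp k, congrArg (fun ρ : Z →[G] Y => ρ.comp k) σ.2⟩ : Lifts f (j.comp k))) ⟨?_, ?_⟩
    fun σ => (T.res_comp _ _ _).symm
  · intro σ τ h
    obtain ⟨z⟩ := hZ'.1
    exact Subtype.ext (hZ.hom_ext (k z) (congrArg (fun ρ => ρ.1 z) h))
  · rintro ⟨τ, hτ⟩
    obtain ⟨z⟩ := hZ'.1
    have hz : f (τ z) = j (k z) := congrArg (fun ρ => ρ z) hτ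
    obtain ⟨σ, hσ⟩ := hZ.exists_hom (k z) (τ z) (by
      rw [← hf (τ z), hz]
      intro γ hγ
      rw [MulAction.mem_stabilizer_iff] at hγ ⊢
      rw [← map_smul, hγ])
    refine ⟨⟨σ, hZ.hom_ext (k z) ?_⟩, Subtype.ext (hZ'.hom_ext z hσ)⟩
    change f (σ (k z)) = j (k z)
    rw [hσ, hz]

/-- An invariant subset of a finite `G`-set. -/
def subGSet (Y : FinGSet G) (P : Y → Prop) (hP : ∀ (γ : G) (y : Y), P y → P (γ • y)) :
    FinGSet G where
  carrier := {y : Y // P y}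
  action :=
    { smul := fun γ y => ⟨γ • y.1, hP γ y.1 y.2⟩
      one_smul := fun y => Subtype.ext (one_smul G y.1)
      mul_smul := fun a b y => Subtype.ext (mul_smul a b y.1) }
  finite := Subtype.finite

/-- The inclusion of an invariant subset. -/
def subGSetIncl (Y : FinGSet G) (P : Y → Prop) (hP : ∀ (γ : G) (y : Y), P y → P (γ • y)) :
    subGSet Y P hP →[G] Y where
  toFun := fun y => y.1
  map_smul' := fun _ _ => rfl

/-- A compatible family of elements indexed by the orbits over `Y` comes from a unique element
of `T(Y)`. -/
theorem existsUnique_of_compatible (n : ℕ) : ∀ (Y : FinGSet G), Nat.card Y ≤ n →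
    ∀ t : ∀ {Z : FinGSet G}, (Z →[G] Y) → T.obj Z,
    (∀ {Z Z' : FinGSet G} (j : Z →[G] Y) (k : Z' →[G] Z), IsOrbit Z → IsOrbit Z' →
      T.res k (t j) = t (j.comp k)) →
    ∃! u : T.obj Y, ∀ {Z : FinGSet G} (j : Z →[G] Y), IsOrbit Z → T.res j u = t j := by
  induction n with
  | zero =>
    intro Y hY t _
    have hE : IsEmpty Y := by
      rw [← Finite.card_eq_zero_iff]
      exact Nat.le_zero.1 hY
    have := T.isMackey.subsingleton_of_isEmpty Y hE
    refine ⟨0, fun j hZ => ?_, fun _ _ => Subsingleton.elim _ _⟩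
    obtain ⟨z⟩ := hZ.1
    exact (hE.false (j z)).elim
  | succ n ih =>
    intro Y hY t ht
    by_cases hE : IsEmpty Y
    · have := T.isMackey.subsingleton_of_isEmpty Y hE
      refine ⟨0, fun j hZ => ?_, fun _ _ => Subsingleton.elim _ _⟩
      obtain ⟨z⟩ := hZ.1
      exact (hE.false (j z)).elim
    rw [not_isEmpty_iff] at hE
    obtain ⟨y₀⟩ := hE
    have hP : ∀ (γ : G) (y : Y), y ∈ MulAction.orbit G y₀ → γ • y ∈ MulAction.orbit G y₀ :=
      fun γ y hy => MulAction.mem_orbit_of_mem_orbit γ hy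
    have hQ : ∀ (γ : G) (y : Y), y ∉ MulAction.orbit G y₀ → γ • y ∉ MulAction.orbit G y₀ :=
      fun γ y hy hy' => hy (by
        simpa using MulAction.mem_orbit_of_mem_orbit γ⁻¹ hy')
    let i₁ := subGSetIncl Y _ hP
    let i₂ := subGSetIncl Y _ hQ
    have hO : IsOrbit (subGSet Y _ hP) := by
      refine ⟨⟨⟨y₀, MulAction.mem_orbit_self y₀⟩⟩, ?_⟩
      rintro ⟨_, ⟨a, rfl⟩⟩ ⟨_, ⟨b, rfl⟩⟩
      refine ⟨b * a⁻¹, Subtype.ext ?_⟩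
      change (b * a⁻¹) • (a • y₀) = b • y₀
      rw [mul_smul, inv_smul_smul]
    have hb : Function.Bijective (Sum.elim i₁ i₂) := by
      constructor
      · rintro (⟨a, ha⟩ | ⟨a, ha⟩) (⟨b, hb⟩ | ⟨b, hb⟩) h
        · obtain rfl : a = b := h
          rfl
        · obtain rfl : a = b := h
          exact (hb ha).elim
        · obtain rfl : a = b := h
          exact (ha hb).elim
        · obtain rfl : a = b := h
          rfl
      · intro y
        by_cases hy : y ∈ MulAction.orbit G y₀
        · exact ⟨Sum.inl ⟨y, hy⟩, rfl⟩
        · exact ⟨Sum.inr ⟨y, hy⟩, rfl⟩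
    have hcard : Nat.card (subGSet Y _ hQ) ≤ n := by
      have h1 : Nat.card (subGSet Y _ hQ) < Nat.card Y :=
        Finite.card_subtype_lt (p := fun y => y ∉ MulAction.orbit G y₀)
          (x := y₀) fun h => h (MulAction.mem_orbit_self y₀)
      omega
    obtain ⟨c, hc, hcu⟩ := ih (subGSet Y _ hQ) hcard (fun j => t (i₂.comp j))
      fun j k hZ hZ' => ht (i₂.comp j) k hZ hZ'
    have hi₁ : Function.Injective i₁ := Subtype.val_injective
    have hi₂ : Function.Injective i₂ := Subtype.val_injective
    have h12 : ∀ a b, i₁ a ≠ i₂ b := fun a b h => b.2 (by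
      have h' : a.1 = b.1 := h
      rw [← h']
      exact a.2)
    have z1 : T.res i₁ (T.tr i₂ c) = 0 :=
      res_tr_of_disjoint (res := fun f => (T.res f : _ →+ _)) (tr := fun f => T.tr f)
        T.isMackey.base_change T.isMackey.subsingleton_of_isEmpty i₂ i₁
        (fun a b => (h12 b a).symm) c
    have z2 : T.res i₂ (T.tr i₁ (t i₁)) = 0 :=
      res_tr_of_disjoint (res := fun f => (T.res f : _ →+ _)) (tr := fun f => T.tr f)
        T.isMackey.base_change T.isMackey.subsingleton_of_isEmpty i₁ i₂ h12 (t i₁)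
    have r1 : T.res i₁ (T.tr i₁ (t i₁) + T.tr i₂ c) = t i₁ := by
      rw [map_add, T.isMackey.res_tr_of_injective i₁ hi₁, z1, add_zero]
    have r2 : T.res i₂ (T.tr i₁ (t i₁) + T.tr i₂ c) = c := by
      rw [map_add, T.isMackey.res_tr_of_injective i₂ hi₂, z2, zero_add]
    refine ⟨T.tr i₁ (t i₁) + T.tr i₂ c, ?_, ?_⟩
    · intro Z j hZ
      obtain ⟨z⟩ := hZ.1
      by_cases hz : j z ∈ MulAction.orbit G y₀
      · have hall : ∀ z', j z' ∈ MulAction.orbit G y₀ := fun z' => by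
          obtain ⟨γ, rfl⟩ := hZ.2 z z'
          rw [map_smul]
          exact hP γ _ hz
        let k : Z →[G] subGSet Y _ hP :=
          { toFun := fun z => ⟨j z, hall z⟩
            map_smul' := fun γ z => Subtype.ext (map_smul j γ z) }
        have hk : j = i₁.comp k := rfl
        rw [hk, T.res_comp, r1]
        exact ht i₁ k hO hZ
      · have hall : ∀ z', j z' ∉ MulAction.orbit G y₀ := fun z' => by
          obtain ⟨γ, rfl⟩ := hZ.2 z z'
          rw [map_smul]
          exact hQ γ _ hz
        let k : Z →[G] subGSet Y _ hQ :=
          { toFun := fun z => ⟨j z, hall z⟩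
            map_smul' := fun γ z => Subtype.ext (map_smul j γ z) }
        have hk : j = i₂.comp k := rfl
        rw [hk, T.res_comp, r2]
        exact hc k hZ
    · intro u hu
      rw [T.isMackey.decomposition_of_bijective (res := fun f => (T.res f : _ →+ _)) i₁ i₂ hb u]
      congr 2
      · exact hu i₁ hO
      · refine hcu _ fun {Z} j hZ => ?_
        change T.res j (T.res i₂ u) = _
        rw [← T.res_comp]
        exact hu _ hZ

theorem existsUnique_norm {X Y : FinGSet G} (f : X →[G] Y) (hf : IsotropyPreserving f)
    (s : T.obj X) : ∃! u : T.obj Y, ∀ {Z : FinGSet G} (j : Z →[G] Y), IsOrbit Z →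
      T.res j u = liftProduct T f s j :=
  existsUnique_of_compatible T _ Y le_rfl (fun j => liftProduct T f s j)
    fun j k hZ hZ' => res_liftProduct T f hf s hZ hZ' j k

/-- The norm `N_f : T(X) → T(Y)` of a Green functor along an isotropy-preserving map `f : X → Y`.
Over each orbit of `Y` such a map is a disjoint union of copies of that orbit, and `N_f` is the
product over the copies: `N_f(s)` is the unique element of `T(Y)` whose restriction along every
map `j : Z → Y` from an orbit is the product of the restrictions of `s` along the lifts of `j`. -/
noncomputable def GreenFunctor.norm {X Y : FinGSet G} (f : X →[G] Y) (hf : IsotropyPreserving f)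
    (s : T.obj X) : T.obj Y :=
  (existsUnique_norm T f hf s).choose

theorem GreenFunctor.res_norm {X Y : FinGSet G} (f : X →[G] Y) (hf : IsotropyPreserving f)
    (s : T.obj X) {Z : FinGSet G} (j : Z →[G] Y) (hZ : IsOrbit Z) :
    T.res j (T.norm f hf s) = ∏ᶠ σ : Lifts f j, T.res σ.1 s :=
  (existsUnique_norm T f hf s).choose_spec.1 j hZ

end Norm

/-! ### Genuine Kähler differentials -/

section Kaehler

/-- A map of `G`-sets is 2-surjective if each of its fibres has at least two elements. -/
def TwoSurjective {X Y : FinGSet G} (f : X →[G] Y) : Prop :=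
  ∀ y : Y, 2 ≤ Nat.card {x : X // f x = y}

/-- An ideal of a Green functor. -/
abbrev GreenIdeal (T : GreenFunctor.{u, v} G) := (GreenModule.self T).Sub

/-- The kernel of a morphism of Green functors. -/
def GreenHom.ker {T : GreenFunctor.{u, v} G} {S : GreenFunctor.{u, w} G} (ψ : GreenHom T S) :
    GreenIdeal T where
  carrier := fun X => RingHom.ker (ψ.app X)
  res_mem := fun {X Y} f m (hm : ψ.app Y m = 0) => by
    exact (ψ.app_res f m).trans ((congrArg (S.res f) hm).trans (map_zero _))
  tr_mem := fun {X Y} f m (hm : ψ.app X m = 0) => by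
    exact (ψ.app_tr f m).trans ((congrArg (S.tr f) hm).trans (map_zero _))

/-- The ideal `J` contains all the norms of elements of `I` along 2-surjective
isotropy-preserving maps. -/
def ContainsNorms {T : GreenFunctor.{u, v} G} (I J : GreenIdeal T) : Prop :=
  ∀ {X Y : FinGSet G} (f : X →[G] Y) (hf : IsotropyPreserving f), TwoSurjective f →
    ∀ i : T.obj X, i ∈ I.carrier X → T.norm f hf i ∈ J.carrier Y

/-- The ideal `I^{>1}`: the smallest ideal containing the norms `N_f(i)` of all elements `i` of
`I` along all 2-surjective isotropy-preserving maps `f`. -/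
def normIdeal {T : GreenFunctor.{u, v} G} (I : GreenIdeal T) : GreenIdeal T where
  carrier := fun X => ⨅ J : {J : GreenIdeal T // ContainsNorms I J}, J.1.carrier X
  res_mem := fun f m hm => by
    rw [Submodule.mem_iInf] at hm ⊢
    exact fun J => J.1.res_mem f (hm J)
  tr_mem := fun f m hm => by
    rw [Submodule.mem_iInf] at hm ⊢
    exact fun J => J.1.tr_mem f (hm J)

/-- The module of genuine Kähler differentials `Ω^{1,G}_{S/R} = I / I^{>1}`, where `I` is the
kernel of the multiplication `S ⊠_R S → S`; it is an `S`-module through the first factor. -/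
def kaehlerDifferentials {R : GreenFunctor.{u, w} G} {S : GreenFunctor.{u, v} G}
    (φ : GreenHom R S) : GreenModule.{u, v, max (u + 1) v} S :=
  ((Box.mulMap φ (Fin 2)).ker.quotientBy (normIdeal (Box.mulMap φ (Fin 2)).ker)).restrictScalars
    (Box.inclusion φ 0)

end Kaehler

end

end EquivariantAlgebra

namespace EquivariantAlgebra

variable {G : Type u} [Group G]

/-! ### Generation of box powers by transfers of products of elements of the factors -/

namespace Box

variable {R : GreenFunctor.{u, w} G} {S : GreenFunctor.{u, v} G} {φ : GreenHom R S} {ι : Type}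
  [Nonempty ι]

/-! The equivariant statement reduces to the classical `HH₁ ≅ I/I²`, because the norms in the
definition of `I^{>1}` produce nothing beyond products. Let `I²` be the ideal generated at each
level by transfers of products `ab` with `a, b ∈ I`.

`I^{>1} = I²` (`mem_normIdeal_iff_mem_squareIdeal`). Membership in an ideal of a Green functor can
be tested on orbits. Over an orbit, a norm along a stabilizer-preserving map with fibres of size at
least two is a product of restrictions with at least two factors, so it lies in `I²`. Conversely,
the norm along the fold map `X ⊔ X → X` of the element with components `a` and `b` is `ab`, so any
ideal containing the norms contains `I²`.

`HH₁` is `S ⊠_R S` modulo boundaries: by commutativity the two faces `C₁ → C₀` agree, so every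
1-chain is a cycle. The map `π(x) = x - μ(x) ⊗ 1` (`kerProj`) is an `S`-linear retraction of `S ⊠_R
S` onto `I`, compatible with restrictions and transfers, with kernel `S ⊗ 1`. Writing `δb = 1 ⊗ b -
b ⊗ 1`, the computation behind the theorem is `d(a ⊗ b ⊗ c) = ab ⊗ c - a ⊗ bc + ac ⊗ b = abc ⊗ 1 -
a·δb·δc`. Applying `π` sends boundaries into `I²`. In the other direction, `s ⊗ 1 = d(s ⊗ 1 ⊗ 1)` is
a boundary, hence so is `a·δb·δc`, and such elements generate `I²` under sums and transfers. Thus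
`x` is a boundary exactly when `π(x) ∈ I^{>1}` (`kerProj_mem_normIdeal_iff`), and `π` induces the
isomorphism.

Everything is checked on pure tensors first. Frobenius reciprocity and base change carry the result
to transfers of pure tensors, which span the box powers. -/

theorem mk_eq_tr_mk_id {X Y : FinGSet G} (p : Y →[G] X) (a : ι → S.obj Y) :
    (mk p a : Box φ ι X) = (green φ ι).tr p (mk (MulActionHom.id G) a : Box φ ι Y) := by
  change _ = tr p (mk (MulActionHom.id G) a)
  rw [tr_mk, MulActionHom.comp_id]

/-- Pure tensors over the identity multiply factor by factor, so forming them is a monoid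
homomorphism on `ι → S.obj X`; it is applied to the factorization of `a` into elements supported at
one index. -/
theorem mk_id_eq_prod_inclusion [Fintype ι] [DecidableEq ι] {X : FinGSet G} (a : ι → S.obj X) :
    (mk (MulActionHom.id G) a : Box φ ι X) = ∏ i, ((inclusion φ i).app X (a i) : Box φ ι X) := by
  let m : (ι → S.obj X) →* Box φ ι X :=
    { toFun := fun a => mk (MulActionHom.id G) a
      map_one' := rfl
      map_mul' := fun a b => by
        rw [mk_id_mul_mk]
        congr 1
        funext k
        rw [S.res_id]
        rfl }
  change m a = _
  conv_lhs => rw [← Finset.univ_prod_mulSingle a, map_prod]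
  rfl

/-- An additive property of elements of a box power holds as soon as it is stable under transfers
and holds for products of elements of the factors. -/
theorem induction_of_tr [Fintype ι] [DecidableEq ι] {P : ∀ X, (green φ ι).obj X → Prop}
    (prod : ∀ X (a : ι → S.obj X), P X (∏ i, (inclusion φ i).app X (a i)))
    (tr : ∀ {X Y : FinGSet G} (p : Y →[G] X) (y : (green φ ι).obj Y), P Y y →
      P X ((green φ ι).tr p y))
    (zero : ∀ X, P X 0) (neg : ∀ X x, P X x → P X (-x))
    (add : ∀ X x y, P X x → P X y → P X (x + y))
    {X : FinGSet G} (x : (green φ ι).obj X) : P X x := by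
  -- The property is a family over all levels because a generator over `X` is a transfer from its
  -- own base `Y`, where the product case is needed.
  refine Box.induction (P := P X) (fun {Y} p a => ?_) (zero X) (neg X) (add X) x
  rw [mk_eq_tr_mk_id, mk_id_eq_prod_inclusion]
  exact tr p _ (prod Y a)

theorem mulMap_inclusion [Fintype ι] [DecidableEq ι] (i : ι) {X : FinGSet G} (s : S.obj X) :
    (mulMap φ ι).app X ((inclusion φ i).app X s) = s := by
  change mulMapHom φ ι X (mk (MulActionHom.id G) (Pi.mulSingle i s)) = s
  rw [mulMapHom_mk, S.tr_id, Fintype.prod_pi_mulSingle' i s]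

end Box

/-! ### The square of an ideal -/

section SquareIdeal

variable {T : GreenFunctor.{u, v} G}

theorem GreenFunctor.tr_mul (T : GreenFunctor.{u, v} G) {X Y : FinGSet G} (f : X →[G] Y)
    (y : T.obj Y) (x : T.obj X) : T.tr f x * y = T.tr f (x * T.res f y) := by
  rw [mul_comm, T.frobenius, mul_comm]

/-- The additive subgroup generated by the transfers to `X` of products of two elements of an
ideal. -/
def squareSubgroup (I : GreenIdeal T) (X : FinGSet G) : AddSubgroup (T.obj X) :=
  AddSubgroup.closure {x | ∃ (Y : FinGSet G) (p : Y →[G] X) (a b : T.obj Y),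
    a ∈ I.carrier Y ∧ b ∈ I.carrier Y ∧ x = T.tr p (a * b)}

theorem tr_mul_mem_squareSubgroup (I : GreenIdeal T) {X Y : FinGSet G} (p : Y →[G] X)
    {a b : T.obj Y} (ha : a ∈ I.carrier Y) (hb : b ∈ I.carrier Y) :
    T.tr p (a * b) ∈ squareSubgroup I X :=
  AddSubgroup.subset_closure ⟨Y, p, a, b, ha, hb, rfl⟩

theorem squareSubgroup_le {I : GreenIdeal T} {X : FinGSet G} {K : AddSubgroup (T.obj X)}
    (h : ∀ {Y : FinGSet G} (p : Y →[G] X) (a b : T.obj Y), a ∈ I.carrier Y →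
      b ∈ I.carrier Y → T.tr p (a * b) ∈ K) : squareSubgroup I X ≤ K := by
  refine (AddSubgroup.closure_le _).2 ?_
  rintro _ ⟨Y, p, a, b, ha, hb, rfl⟩
  exact h p a b ha hb

/-- Frobenius reciprocity moves `t` inside the transfer, where the first factor absorbs it. Phrasing
this and the next two closure properties as inclusions into a `comap` leaves only generators to
check; those two use base change and functoriality of transfers. -/
theorem mul_mem_squareSubgroup (I : GreenIdeal T) {X : FinGSet G} (t : T.obj X) :
    squareSubgroup I X ≤ (squareSubgroup I X).comap (AddMonoidHom.mulLeft t) :=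
  squareSubgroup_le fun {Y} p a b ha hb => by
    change t * T.tr p (a * b) ∈ squareSubgroup I X
    rw [T.frobenius, ← mul_assoc]
    exact tr_mul_mem_squareSubgroup I p ((I.carrier Y).smul_mem _ ha) hb

theorem res_mem_squareSubgroup (I : GreenIdeal T) {X Y : FinGSet G} (f : X →[G] Y) :
    squareSubgroup I Y ≤ (squareSubgroup I X).comap (T.res f : T.obj Y →+ T.obj X) :=
  squareSubgroup_le fun p a b ha hb => by
    change T.res f (T.tr p (a * b)) ∈ squareSubgroup I X
    rw [T.base_change (isPullbackSquare_fibre p f), map_mul]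
    exact tr_mul_mem_squareSubgroup I _ (I.res_mem _ ha) (I.res_mem _ hb)

theorem tr_mem_squareSubgroup (I : GreenIdeal T) {X Y : FinGSet G} (f : X →[G] Y) :
    squareSubgroup I X ≤ (squareSubgroup I Y).comap (T.tr f) :=
  squareSubgroup_le fun p a b ha hb => by
    change T.tr f (T.tr p (a * b)) ∈ squareSubgroup I Y
    rw [← T.tr_comp]
    exact tr_mul_mem_squareSubgroup I _ ha hb

/-- The square of an ideal of a Green functor: the smallest ideal containing all products of two
elements of the ideal at the same level. -/
def squareIdeal (I : GreenIdeal T) : GreenIdeal T where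
  carrier := fun X =>
    { squareSubgroup I X with smul_mem' := fun t _ hx => mul_mem_squareSubgroup I t hx }
  res_mem := fun f _ hm => res_mem_squareSubgroup I f hm
  tr_mem := fun f _ hm => tr_mem_squareSubgroup I f hm

theorem mul_mem_squareIdeal (I : GreenIdeal T) {X : FinGSet G} {a b : T.obj X}
    (ha : a ∈ I.carrier X) (hb : b ∈ I.carrier X) : a * b ∈ (squareIdeal I).carrier X := by
  rw [← T.tr_id (a * b)]
  exact tr_mul_mem_squareSubgroup I _ ha hb

end SquareIdeal

/-! ### Norms of elements of an ideal -/

section NormIdeal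

variable {T : GreenFunctor.{u, v} G}

/-- Membership in an ideal of a Green functor is detected on orbits. -/
theorem GreenIdeal.mem_of_forall_orbit (J : GreenIdeal T) {Y : FinGSet G} (x : T.obj Y)
    (hx : ∀ {Z : FinGSet G} (j : Z →[G] Y), IsOrbit Z → T.res j x ∈ J.carrier Z) :
    x ∈ J.carrier Y := by
  -- Strong induction on the size of `Y`: one orbit is split off by `i₁`, its complement by `i₂`.
  -- The element is recovered from its two restrictions by transfers, and `J` is closed under
  -- transfers.
  induction hn : Nat.card Y using Nat.strong_induction_on generalizing Y with
  | _ n ih =>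
  by_cases hE : IsEmpty Y
  · have := T.isMackey.subsingleton_of_isEmpty Y hE
    rw [Subsingleton.elim x 0]
    exact zero_mem _
  rw [not_isEmpty_iff] at hE
  obtain ⟨y₀⟩ := hE
  have hP : ∀ (γ : G) (y : Y), y ∈ MulAction.orbit G y₀ → γ • y ∈ MulAction.orbit G y₀ :=
    fun γ y hy => MulAction.mem_orbit_of_mem_orbit γ hy
  have hQ : ∀ (γ : G) (y : Y), y ∉ MulAction.orbit G y₀ → γ • y ∉ MulAction.orbit G y₀ :=
    fun γ y hy hy' => hy (by simpa using MulAction.mem_orbit_of_mem_orbit γ⁻¹ hy')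
  let i₁ := subGSetIncl Y _ hP
  let i₂ := subGSetIncl Y _ hQ
  have hO : IsOrbit (subGSet Y _ hP) := by
    refine ⟨⟨⟨y₀, MulAction.mem_orbit_self y₀⟩⟩, ?_⟩
    rintro ⟨_, ⟨a, rfl⟩⟩ ⟨_, ⟨b, rfl⟩⟩
    refine ⟨b * a⁻¹, Subtype.ext ?_⟩
    change (b * a⁻¹) • (a • y₀) = b • y₀
    rw [mul_smul, inv_smul_smul]
  have hb : Function.Bijective (Sum.elim i₁ i₂) := by
    constructor
    · rintro (⟨a, ha⟩ | ⟨a, ha⟩) (⟨b, hb⟩ | ⟨b, hb⟩) h <;> obtain rfl : a = b := h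
      · rfl
      · exact (hb ha).elim
      · exact (ha hb).elim
      · rfl
    · intro y
      by_cases hy : y ∈ MulAction.orbit G y₀
      · exact ⟨Sum.inl ⟨y, hy⟩, rfl⟩
      · exact ⟨Sum.inr ⟨y, hy⟩, rfl⟩
  have hcard : Nat.card (subGSet Y _ hQ) < n := hn ▸
    Finite.card_subtype_lt (p := fun y => y ∉ MulAction.orbit G y₀)
      (x := y₀) fun h => h (MulAction.mem_orbit_self y₀)
  rw [T.isMackey.decomposition_of_bijective (res := fun f => (T.res f : _ →+ _)) i₁ i₂ hb x]
  refine add_mem (J.tr_mem i₁ (hx i₁ hO)) (J.tr_mem i₂ (ih _ hcard _ (fun {Z} j hZ => ?_) rfl))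
  change T.res j (T.res i₂ x) ∈ _
  rw [← T.res_comp]
  exact hx _ hZ

/-- Evaluation at a point `z` identifies the lifts of `j` with the fibre of `f` over `j z`: a map
out of an orbit is determined by its value at `z`, and stabilizer preservation lets every point of
the fibre occur as a value. Fibres of size at least two therefore give two distinct lifts. -/
theorem nontrivial_lifts {X Y Z : FinGSet G} (f : X →[G] Y) (hf : IsotropyPreserving f)
    (h2 : TwoSurjective f) (hZ : IsOrbit Z) (j : Z →[G] Y) : Nontrivial (Lifts f j) := by
  obtain ⟨z⟩ := hZ.1
  have hfib := h2 (j z)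
  rw [← Nat.lt_iff_add_one_le, Finite.one_lt_card_iff_nontrivial] at hfib
  obtain ⟨⟨x, hx⟩, ⟨x', hx'⟩, hne⟩ := hfib
  have hlift : ∀ x : X, f x = j z → ∃ σ : Lifts f j, σ.1 z = x := fun x hx => by
    obtain ⟨σ, hσ⟩ := hZ.exists_hom z x (by
      -- The stabilizer of `x` equals that of `f x = j z`, which contains the stabilizer of `z`.
      rw [← hf x, hx]
      intro γ hγ
      rw [MulAction.mem_stabilizer_iff] at hγ ⊢
      rw [← map_smul, hγ])
    exact ⟨⟨σ, hZ.hom_ext z ((congrArg f hσ).trans hx)⟩, hσ⟩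
  obtain ⟨σ, hσ⟩ := hlift x hx
  obtain ⟨σ', hσ'⟩ := hlift x' hx'
  refine ⟨σ, σ', fun h => hne (Subtype.ext ?_)⟩
  change x = x'
  rw [← hσ, ← hσ', h]

/-- On an orbit the norm is a product over lifts. Two distinct lifts contribute a product of two
elements of `I`, and the remaining factors are absorbed because `I²` is an ideal. -/
theorem containsNorms_squareIdeal (I : GreenIdeal T) : ContainsNorms I (squareIdeal I) := by
  classical
  intro X Y f hf h2 i hi
  refine GreenIdeal.mem_of_forall_orbit _ _ fun {Z} j hZ => ?_
  have := finite_lifts f j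
  have := Fintype.ofFinite (Lifts f j)
  obtain ⟨σ, τ, hne⟩ := nontrivial_lifts f hf h2 hZ j
  rw [T.res_norm f hf i j hZ, finprod_eq_prod_of_fintype,
    ← Finset.mul_prod_erase _ _ (Finset.mem_univ σ),
    ← Finset.mul_prod_erase _ _ (Finset.mem_erase.2 ⟨hne.symm, Finset.mem_univ τ⟩),
    ← mul_assoc, mul_comm]
  exact ((squareIdeal I).carrier Z).smul_mem _
    (mul_mem_squareIdeal I (I.res_mem σ.1 hi) (I.res_mem τ.1 hi))

/-- The fold map `X ⊔ X → X`. -/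
def foldMap (X : FinGSet G) : disjointUnion X X →[G] X where
  toFun := Sum.elim id id
  map_smul' := by
    rintro γ (x | x) <;> rfl

theorem isotropyPreserving_foldMap (X : FinGSet G) : IsotropyPreserving (foldMap X) := by
  rintro (x | x) <;> ext γ
  · exact ⟨fun h => congrArg Sum.inl h, fun h => Sum.inl_injective h⟩
  · exact ⟨fun h => congrArg Sum.inr h, fun h => Sum.inr_injective h⟩

theorem twoSurjective_foldMap (X : FinGSet G) : TwoSurjective (foldMap X) := by
  intro x
  rw [← Nat.lt_iff_add_one_le, Finite.one_lt_card_iff_nontrivial]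
  exact ⟨⟨inlMap X X x, rfl⟩, ⟨inrMap X X x, rfl⟩, fun h => Sum.inl_ne_inr (congrArg Subtype.val h)⟩

/-- The norm along the fold map is the product. -/
theorem norm_foldMap {X : FinGSet G} (s : T.obj (disjointUnion X X)) :
    T.norm (foldMap X) (isotropyPreserving_foldMap X) s =
      T.res (inlMap X X) s * T.res (inrMap X X) s := by
  classical
  -- Both sides are compared through the universal property of the norm, so only restrictions to
  -- orbits have to be computed.
  refine (existsUnique_norm T (foldMap X) (isotropyPreserving_foldMap X) s).unique
    (fun j hZ => T.res_norm _ _ s j hZ) fun {Z} j hZ => ?_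
  have := finite_lifts (foldMap X) j
  have := Fintype.ofFinite (Lifts (foldMap X) j)
  let σ : Lifts (foldMap X) j := ⟨(inlMap X X).comp j, rfl⟩
  let τ : Lifts (foldMap X) j := ⟨(inrMap X X).comp j, rfl⟩
  obtain ⟨z⟩ := hZ.1
  have hne : σ ≠ τ := fun h => Sum.inl_ne_inr (congrArg (fun ρ => ρ.1 z) h)
  -- An orbit maps into one of the two copies of `X`, and the copy is read off from the image of
  -- `z`; hence `σ` and `τ` are the only lifts.
  have huniv : (Finset.univ : Finset (Lifts (foldMap X) j)) = {σ, τ} := by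
    refine (Finset.eq_univ_of_forall fun ρ => ?_).symm
    have hρ : foldMap X (ρ.1 z) = j z := congrArg (fun ρ => ρ z) ρ.2
    rw [Finset.mem_insert, Finset.mem_singleton]
    rcases hx : (show (X : Type u) ⊕ (X : Type u) from ρ.1 z) with x | x
    · refine Or.inl (Subtype.ext (hZ.hom_ext z (Eq.trans hx ?_)))
      have hx' : ρ.1 z = inlMap X X x := hx
      rw [hx'] at hρ
      exact congrArg Sum.inl hρ
    · refine Or.inr (Subtype.ext (hZ.hom_ext z (Eq.trans hx ?_)))
      have hx' : ρ.1 z = inrMap X X x := hx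
      rw [hx'] at hρ
      exact congrArg Sum.inr hρ
  unfold liftProduct
  rw [finprod_eq_prod_of_fintype, huniv, Finset.prod_pair hne, map_mul, ← T.res_comp, ← T.res_comp]

theorem mem_normIdeal {I : GreenIdeal T} {X : FinGSet G} {x : T.obj X} :
    x ∈ (normIdeal I).carrier X ↔ ∀ J : GreenIdeal T, ContainsNorms I J → x ∈ J.carrier X := by
  refine (Submodule.mem_iInf fun J : {J : GreenIdeal T // ContainsNorms I J} =>
    J.1.carrier X).trans ?_
  exact Subtype.forall

/-- By additivity there is an element of `T(X ⊔ X)` with components `a` and `b`; its norm along the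
fold map is `ab`. -/
theorem ContainsNorms.mul_mem {I J : GreenIdeal T} (h : ContainsNorms I J) {X : FinGSet G}
    {a b : T.obj X} (ha : a ∈ I.carrier X) (hb : b ∈ I.carrier X) : a * b ∈ J.carrier X := by
  obtain ⟨s, hs⟩ := (T.isMackey.bijective_disjointUnion X X).2 (a, b)
  have hsa : T.res (inlMap X X) s = a := congrArg Prod.fst hs
  have hsb : T.res (inrMap X X) s = b := congrArg Prod.snd hs
  -- The element lies in `I` since it is the sum of the transfers of its components along the two
  -- inclusions.
  have hsI : s ∈ I.carrier _ := by
    rw [T.isMackey.decomposition (res := fun f => (T.res f : _ →+ _)) s]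
    refine add_mem (I.tr_mem _ ?_) (I.tr_mem _ ?_)
    · change T.res (inlMap X X) s ∈ _
      rwa [hsa]
    · change T.res (inrMap X X) s ∈ _
      rwa [hsb]
  have := h (foldMap X) (isotropyPreserving_foldMap X) (twoSurjective_foldMap X) s hsI
  rwa [norm_foldMap, hsa, hsb] at this

/-- The ideal `I^{>1}` generated by norms is the square of `I`. -/
theorem mem_normIdeal_iff_mem_squareIdeal (I : GreenIdeal T) {X : FinGSet G} (x : T.obj X) :
    x ∈ (normIdeal I).carrier X ↔ x ∈ (squareIdeal I).carrier X := by
  rw [mem_normIdeal]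
  refine ⟨fun h => h _ (containsNorms_squareIdeal I), fun hx J hJ => ?_⟩
  -- It suffices to treat generators `tr(ab)`: the product is in `J` by the fold map, and `J` is
  -- closed under transfers.
  exact squareSubgroup_le (K := (J.carrier X).toAddSubgroup)
    (fun p a b ha hb => J.tr_mem p (hJ.mul_mem ha hb)) hx

end NormIdeal

/-! ### Comparison of Hochschild 1-chains with the kernel of the multiplication -/

section HochschildKaehler

variable {R : GreenFunctor.{u, w} G} {S : GreenFunctor.{u, v} G} (φ : GreenHom R S)

/-- The projection `x ↦ x - μ(x) ⊗ 1` of `S ⊠_R S` onto the kernel of the multiplication `μ`. -/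
def kerProj (X : FinGSet G) :
    (Box.green φ (Fin 2)).obj X →+ (Box.green φ (Fin 2)).obj X :=
  AddMonoidHom.id _ - ((Box.inclusion φ (0 : Fin 2)).app X : S.obj X →+ _).comp
    ((Box.mulMap φ (Fin 2)).app X : _ →+ S.obj X)

theorem kerProj_apply {X : FinGSet G} (x : (Box.green φ (Fin 2)).obj X) :
    kerProj φ X x = x - (Box.inclusion φ 0).app X ((Box.mulMap φ (Fin 2)).app X x) := rfl

theorem kerProj_mem {X : FinGSet G} (x : (Box.green φ (Fin 2)).obj X) :
    kerProj φ X x ∈ (Box.mulMap φ (Fin 2)).ker.carrier X := by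
  change (Box.mulMap φ (Fin 2)).app X (kerProj φ X x) = 0
  rw [kerProj_apply, map_sub, Box.mulMap_inclusion, sub_self]

theorem kerProj_of_mem {X : FinGSet G} {x : (Box.green φ (Fin 2)).obj X}
    (hx : x ∈ (Box.mulMap φ (Fin 2)).ker.carrier X) : kerProj φ X x = x := by
  have hx' : (Box.mulMap φ (Fin 2)).app X x = 0 := hx
  rw [kerProj_apply, hx', map_zero, sub_zero]

theorem kerProj_res {X Y : FinGSet G} (f : X →[G] Y) (x : (Box.green φ (Fin 2)).obj Y) :
    kerProj φ X ((Box.green φ (Fin 2)).res f x) =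
      (Box.green φ (Fin 2)).res f (kerProj φ Y x) := by
  rw [kerProj_apply, kerProj_apply, map_sub, GreenHom.app_res, GreenHom.app_res]

theorem kerProj_tr {X Y : FinGSet G} (f : X →[G] Y) (x : (Box.green φ (Fin 2)).obj X) :
    kerProj φ Y ((Box.green φ (Fin 2)).tr f x) =
      (Box.green φ (Fin 2)).tr f (kerProj φ X x) := by
  rw [kerProj_apply, kerProj_apply, map_sub, GreenHom.app_tr, GreenHom.app_tr]

theorem kerProj_inclusion_mul {X : FinGSet G} (s : S.obj X) (x : (Box.green φ (Fin 2)).obj X) :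
    kerProj φ X ((Box.inclusion φ 0).app X s * x) =
      (Box.inclusion φ 0).app X s * kerProj φ X x := by
  rw [kerProj_apply, kerProj_apply, map_mul, Box.mulMap_inclusion, map_mul, mul_sub]

/-- The image of `a ⊗ b` is `a·δb` with `δb = 1 ⊗ b - b ⊗ 1`. Since `kerProj` maps onto `I`, sums of
transfers of such elements exhaust `I`. -/
theorem kerProj_mul {X : FinGSet G} (a b : S.obj X) :
    kerProj φ X ((Box.inclusion φ 0).app X a * (Box.inclusion φ 1).app X b) =
      (Box.inclusion φ 0).app X a *
        ((Box.inclusion φ 1).app X b - (Box.inclusion φ 0).app X b) := by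
  rw [kerProj_inclusion_mul, kerProj_apply, Box.mulMap_inclusion]

/-- The faces send `a₀ ⊗ a₁` to `a₀a₁` and `a₁a₀`, which agree by commutativity. Hence all 1-chains
are cycles. -/
theorem hochschildBoundary_zero_app {X : FinGSet G} (x : (hochschildChains φ 1).obj X) :
    (hochschildBoundary φ 0).app X x = 0 := by
  have h : hochschildFace φ 0 0 = hochschildFace φ 0 1 := by
    unfold hochschildFace
    -- The two faces come from index maps into the one-element type `Fin 1`, which must be equal.
    congr! 4
  simp [hochschildBoundary, h]

/-- The Hochschild differential `C_2 → C_1`, as an additive homomorphism between box powers. -/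
def boundaryHom (X : FinGSet G) :
    (Box.green φ (Fin 3)).obj X →+ (Box.green φ (Fin 2)).obj X :=
  ((Box.map φ (faceIndex 1 0)).app X : _ →+ (Box.green φ (Fin 2)).obj X) -
    ((Box.map φ (faceIndex 1 1)).app X : _ →+ (Box.green φ (Fin 2)).obj X) +
    ((Box.map φ (faceIndex 1 2)).app X : _ →+ (Box.green φ (Fin 2)).obj X)

theorem boundaryHom_apply {X : FinGSet G} (x : (Box.green φ (Fin 3)).obj X) :
    boundaryHom φ X x = (Box.map φ (faceIndex 1 0)).app X x -
      (Box.map φ (faceIndex 1 1)).app X x + (Box.map φ (faceIndex 1 2)).app X x := rfl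

theorem hochschildBoundary_one_app {X : FinGSet G} (x : (hochschildChains φ 2).obj X) :
    (hochschildBoundary φ 1).app X x = boundaryHom φ X x := by
  have h : (hochschildBoundary φ 1).app X x = (hochschildFace φ 1 0).app X x -
      (hochschildFace φ 1 1).app X x + (hochschildFace φ 1 2).app X x := by
    simp [hochschildBoundary, Fin.sum_univ_three, sub_eq_add_neg]
  exact h

theorem boundaryHom_tr {X Y : FinGSet G} (p : Y →[G] X) (x : (Box.green φ (Fin 3)).obj Y) :
    boundaryHom φ X ((Box.green φ (Fin 3)).tr p x) =
      (Box.green φ (Fin 2)).tr p (boundaryHom φ Y x) := by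
  rw [boundaryHom_apply, boundaryHom_apply, map_add, map_sub, GreenHom.app_tr, GreenHom.app_tr,
    GreenHom.app_tr]

/-- A face map is a ring homomorphism sending the inclusion of factor `i` to that of the image
index, so the formula is read off from the index maps; the last face wraps `c` around to position
`0`. -/
theorem boundaryHom_mul {X : FinGSet G} (a b c : S.obj X) :
    boundaryHom φ X ((Box.inclusion φ 0).app X a * (Box.inclusion φ 1).app X b *
        (Box.inclusion φ 2).app X c) =
      (Box.inclusion φ 0).app X a * (Box.inclusion φ 0).app X b * (Box.inclusion φ 1).app X c -
        (Box.inclusion φ 0).app X a * (Box.inclusion φ 1).app X b * (Box.inclusion φ 1).app X c +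
        (Box.inclusion φ 0).app X a * (Box.inclusion φ 1).app X b *
          (Box.inclusion φ 0).app X c := by
  have h01 : faceIndex 1 0 1 = 0 := by decide
  have h02 : faceIndex 1 0 2 = 1 := by decide
  have h11 : faceIndex 1 1 1 = 1 := by decide
  have h12 : faceIndex 1 1 2 = 1 := by decide
  have h21 : faceIndex 1 2 1 = 1 := by decide
  have h22 : faceIndex 1 2 2 = 0 := by decide
  simp only [boundaryHom_apply, map_mul, Box.map_inclusion, faceIndex_zero, h01, h02, h11, h12,
    h21, h22]

theorem inclusion_sub_inclusion_mem {X : FinGSet G} (s : S.obj X) :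
    (Box.inclusion φ 1).app X s - (Box.inclusion φ 0).app X s ∈
      (Box.mulMap φ (Fin 2)).ker.carrier X := by
  have h : (Box.mulMap φ (Fin 2)).app X
      ((Box.inclusion φ 1).app X s - (Box.inclusion φ 0).app X s) = 0 := by
    rw [map_sub, Box.mulMap_inclusion, Box.mulMap_inclusion, sub_self]
  exact h

/-- The multiplication sends the boundary to `abc - abc + acb = abc`, so `kerProj` subtracts exactly
`abc ⊗ 1`, the term missing from the expansion of `-a·δb·δc`. This is the Leibniz rule for `δ`
modulo `I²`. -/
theorem kerProj_boundaryHom_mul {X : FinGSet G} (a b c : S.obj X) :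
    kerProj φ X (boundaryHom φ X ((Box.inclusion φ 0).app X a * (Box.inclusion φ 1).app X b *
        (Box.inclusion φ 2).app X c)) =
      -((Box.inclusion φ 0).app X a *
        (((Box.inclusion φ 1).app X b - (Box.inclusion φ 0).app X b) *
          ((Box.inclusion φ 1).app X c - (Box.inclusion φ 0).app X c))) := by
  rw [boundaryHom_mul, kerProj_apply]
  simp only [map_sub, map_add, map_mul, Box.mulMap_inclusion]
  ring

theorem kerProj_boundaryHom_mem {X : FinGSet G} (x : (Box.green φ (Fin 3)).obj X) :
    kerProj φ X (boundaryHom φ X x) ∈ squareSubgroup (Box.mulMap φ (Fin 2)).ker X := by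
  refine Box.induction_of_tr (P := fun X x => kerProj φ X (boundaryHom φ X x) ∈
      squareSubgroup (Box.mulMap φ (Fin 2)).ker X) (fun X a => ?_) (fun p y hy => ?_)
      (fun X => ?_) (fun X x hx => ?_) (fun X x y hx hy => ?_) x
  · rw [Fin.prod_univ_three, kerProj_boundaryHom_mul]
    exact neg_mem (mul_mem_squareSubgroup _ ((Box.inclusion φ 0).app X (a 0))
      (mul_mem_squareIdeal _ (inclusion_sub_inclusion_mem φ (a 1)) (inclusion_sub_inclusion_mem φ (a 2))))
  · rw [boundaryHom_tr, kerProj_tr]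
    exact tr_mem_squareSubgroup _ p hy
  · rw [map_zero, map_zero]
    exact zero_mem _
  · rw [map_neg, map_neg]
    exact neg_mem hx
  · rw [map_add, map_add]
    exact add_mem hx hy

/-- In `d(s ⊗ 1 ⊗ 1) = s ⊗ 1 - s ⊗ 1 + s ⊗ 1` one copy survives. Consequently `x` and `kerProj φ X
x` differ by a boundary. -/
theorem inclusion_mem_range_boundaryHom {X : FinGSet G} (s : S.obj X) :
    (Box.inclusion φ 0).app X s ∈ (boundaryHom φ X).range := by
  refine ⟨_, (boundaryHom_mul φ s 1 1).trans ?_⟩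
  simp only [map_one, mul_one, sub_self, zero_add]

theorem tr_mem_range_boundaryHom {X Y : FinGSet G} (p : Y →[G] X)
    {x : (Box.green φ (Fin 2)).obj Y} (hx : x ∈ (boundaryHom φ Y).range) :
    (Box.green φ (Fin 2)).tr p x ∈ (boundaryHom φ X).range := by
  obtain ⟨y, rfl⟩ := hx
  exact ⟨_, boundaryHom_tr φ p y⟩

/-- For pure tensors the product is `a₀b₀·δa₁·δb₁`, which equals `a₀b₀a₁b₁ ⊗ 1 - d(a₀b₀ ⊗ a₁ ⊗ b₁)`.
Bilinearity and Frobenius reciprocity extend this to all `x` and `y`. -/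
theorem kerProj_mul_kerProj_mem {X : FinGSet G} (x y : (Box.green φ (Fin 2)).obj X) :
    kerProj φ X x * kerProj φ X y ∈ (boundaryHom φ X).range := by
  -- The second argument stays universally quantified: pulling a transfer out of the first factor
  -- replaces `y` by its restriction. In the inner induction the family `a` is quantified for the
  -- same reason.
  refine Box.induction_of_tr (P := fun X x => ∀ y, kerProj φ X x * kerProj φ X y ∈
    (boundaryHom φ X).range) (fun X a y => ?_) (fun p x hx y => ?_) (fun X y => ?_)
    (fun X x hx y => ?_) (fun X x x' hx hx' y => ?_) x y
  · refine Box.induction_of_tr (P := fun X y => ∀ a : Fin 2 → S.obj X,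
      kerProj φ X (∏ i, (Box.inclusion φ i).app X (a i)) * kerProj φ X y ∈
      (boundaryHom φ X).range) (fun X b a => ?_) (fun p y hy a => ?_) (fun X a => ?_)
      (fun X y hy a => ?_) (fun X y y' hy hy' a => ?_) y a
    · rw [Fin.prod_univ_two, Fin.prod_univ_two, kerProj_mul, kerProj_mul]
      have h1 : _ ∈ (boundaryHom φ X).range :=
        ⟨_, boundaryHom_mul φ (a 0 * b 0) (a 1) (b 1)⟩
      have h2 := inclusion_mem_range_boundaryHom φ (a 0 * b 0 * a 1 * b 1)
      convert sub_mem (neg_mem h1) (neg_mem h2) using 1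
      simp only [map_mul]
      ring
    -- The restriction of a product of factor inclusions is again one, with each `a i` restricted,
    -- so the inductive hypothesis applies to the restricted family.
    · rw [kerProj_tr, GreenFunctor.frobenius, ← kerProj_res, map_prod]
      simp only [← GreenHom.app_res]
      exact tr_mem_range_boundaryHom φ p (hy _)
    · rw [map_zero, mul_zero]
      exact zero_mem _
    · rw [map_neg, mul_neg]
      exact neg_mem (hy a)
    · rw [map_add, mul_add]
      exact add_mem (hy a) (hy' a)
  · rw [kerProj_tr, GreenFunctor.tr_mul, ← kerProj_res]
    exact tr_mem_range_boundaryHom φ p (hx _)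
  · rw [map_zero, zero_mul]
    exact zero_mem _
  · rw [map_neg, neg_mul]
    exact neg_mem (hx y)
  · rw [map_add, add_mul]
    exact add_mem (hx y) (hx' y)

/-- Elements of `I` are fixed by `kerProj`, so the previous product statement covers all generators
of `I²`. -/
theorem squareSubgroup_le_range_boundaryHom (X : FinGSet G) :
    squareSubgroup (Box.mulMap φ (Fin 2)).ker X ≤ (boundaryHom φ X).range :=
  squareSubgroup_le fun p a b ha hb => by
    refine tr_mem_range_boundaryHom φ p ?_
    rw [← kerProj_of_mem φ ha, ← kerProj_of_mem φ hb]
    exact kerProj_mul_kerProj_mem φ a b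

/-- A Hochschild chain of degree one is a boundary if and only if its projection to the kernel `I`
of the multiplication lies in `I^{>1}`. -/
theorem kerProj_mem_normIdeal_iff {X : FinGSet G} (x : (Box.green φ (Fin 2)).obj X) :
    kerProj φ X x ∈ (normIdeal (Box.mulMap φ (Fin 2)).ker).carrier X ↔
      x ∈ (boundaryHom φ X).range := by
  rw [mem_normIdeal_iff_mem_squareIdeal]
  constructor
  · intro h
    have h1 := squareSubgroup_le_range_boundaryHom φ X h
    rw [kerProj_apply] at h1
    -- This adds back `μ(x) ⊗ 1`, itself a boundary, to recover `x` from its projection.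
    simpa using add_mem h1 (inclusion_mem_range_boundaryHom φ ((Box.mulMap φ (Fin 2)).app X x))
  · rintro ⟨y, rfl⟩
    exact kerProj_boundaryHom_mem φ y

/-! ### The isomorphism induced by the projection -/

/-- The map from Hochschild cycles of degree one to genuine Kähler differentials sending `x` to the
class of `x - μ(x) ⊗ 1`. -/
def cyclesToKaehler (X : FinGSet G) :
    (hochschildCycles φ 1).carrier X →ₗ[S.obj X] (kaehlerDifferentials φ).obj X where
  toFun := fun x => Submodule.Quotient.mk (⟨kerProj φ X x.1, kerProj_mem φ x.1⟩ :
    (Box.mulMap φ (Fin 2)).ker.carrier X)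
  map_add' := fun x y => congrArg Submodule.Quotient.mk
    (Subtype.ext (map_add (kerProj φ X) x.1 y.1))
  map_smul' := fun s x => congrArg Submodule.Quotient.mk
    (Subtype.ext (kerProj_inclusion_mul φ s x.1))

theorem cyclesToKaehler_surjective (X : FinGSet G) :
    Function.Surjective (cyclesToKaehler φ X) := by
  intro y
  obtain ⟨⟨x, hx⟩, rfl⟩ := Submodule.Quotient.mk_surjective _ y
  -- An element of `I` is itself a cycle and is fixed by the projection, so it represents its own
  -- class.
  exact ⟨⟨x, hochschildBoundary_zero_app φ x⟩,
    congrArg Submodule.Quotient.mk (Subtype.ext (kerProj_of_mem φ hx))⟩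

/-- The class of `kerProj φ X x` vanishes exactly when it lies in `I^{>1}`, that is, when `x` is a
boundary. With surjectivity, this is the input to the first isomorphism theorem at level `X`. -/
theorem ker_cyclesToKaehler (X : FinGSet G) :
    LinearMap.ker (cyclesToKaehler φ X) =
      ((GreenModule.range (hochschildBoundary φ 1)).carrier X).submoduleOf
        ((hochschildCycles φ 1).carrier X) := by
  ext x
  exact (Submodule.Quotient.mk_eq_zero _).trans <| (kerProj_mem_normIdeal_iff φ x.1).trans <|
    exists_congr fun y => iff_of_eq (congrArg (· = x.1) (hochschildBoundary_one_app φ y).symm)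

/-- The isomorphism at the level `X` between Hochschild homology of degree one and genuine Kähler
differentials. -/
noncomputable def hochschildHomologyOneEquiv (X : FinGSet G) :
    (hochschildHomology φ 1).obj X ≃ₗ[S.obj X] (kaehlerDifferentials φ).obj X :=
  let e := (Submodule.quotEquivOfEq _ _ (ker_cyclesToKaehler φ X).symm).trans
    ((cyclesToKaehler φ X).quotKerEquivOfSurjective (cyclesToKaehler_surjective φ X))
  e

/-- The isomorphism between Hochschild homology of degree one and genuine Kähler differentials. -/
noncomputable def hochschildHomologyOneIso :
    GreenModule.Iso (hochschildHomology φ 1) (kaehlerDifferentials φ) where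
  app := hochschildHomologyOneEquiv φ
  app_res := fun {X Y} f m => by
    obtain ⟨m, rfl⟩ := Submodule.Quotient.mk_surjective _ m
    -- Restrictions on both quotients are computed on representatives, so compatibility reduces to
    -- that of `kerProj` with restriction; the case of transfers is parallel.
    have h : (⟨_, kerProj_mem φ ((Box.green φ (Fin 2)).res f m.1)⟩ :
        (Box.mulMap φ (Fin 2)).ker.carrier X) =
        (Box.mulMap φ (Fin 2)).ker.subRes f ⟨_, kerProj_mem φ m.1⟩ :=
      Subtype.ext (kerProj_res φ f m.1)
    exact congrArg Submodule.Quotient.mk h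
  app_tr := fun {X Y} f m => by
    obtain ⟨m, rfl⟩ := Submodule.Quotient.mk_surjective _ m
    have h : (⟨_, kerProj_mem φ ((Box.green φ (Fin 2)).tr f m.1)⟩ :
        (Box.mulMap φ (Fin 2)).ker.carrier Y) =
        (Box.mulMap φ (Fin 2)).ker.subTr f ⟨_, kerProj_mem φ m.1⟩ :=
      Subtype.ext (kerProj_tr φ f m.1)
    exact congrArg Submodule.Quotient.mk h

end HochschildKaehler

end EquivariantAlgebra

theorem mainTheorem7 {G : Type u} [Group G] [Finite G]
    (R : EquivariantAlgebra.GreenFunctor.{u, w} G) (S : EquivariantAlgebra.GreenFunctor.{u, v} G)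
    (φ : EquivariantAlgebra.GreenHom R S) :
    Nonempty (EquivariantAlgebra.GreenModule.Iso
      (EquivariantAlgebra.hochschildHomology φ 1)
      (EquivariantAlgebra.kaehlerDifferentials φ)) :=
  ⟨EquivariantAlgebra.hochschildHomologyOneIso φ⟩
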